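/- **Theorem 6.1 (abstract constructive Krein–Rutman–Doblin–Harris theorem).** Let $X$, $Y$ be real Banach lattices and $\langle\cdot,\cdot\rangle : Y\times X\to\mathbb R$ a continuous bilinear bracket such that $f\ge 0$ iff $\langle\psi,f\rangle\ge0$ for all $\psi\in Y_+$, and $\phi\ge0$ iff $\langle\phi,g\rangle\ge 0$ for all $g\in X_+$. Let $S=(S_t)_{t\ge0}$ be a positive strongly continuous semigroup on $X$ with generator $\mathcal L$ and $S^*=(S^*_t)_{t\ge0}$ a strongly continuous semigroup on $Y$ with generator $\mathcal L^*$ such that $\langle\phi,S_tf\rangle=\langle S_t^*\phi,f\rangle$ for all $f\in X$, $\phi\in Y$, $t\ge0$. For $\psi\in Y_+$, $g\in X_+$ put $[f]_\psi:=\langle\psi,|f|\rangle$ and $[\phi]_g:=\langle|\phi|,g\rangle$. Let $\|\cdot\|_0,\|\cdot\|_1$ be lattice norms on $X$ and on $Y$ (that is, $|x|\le|y|$ implies $\|x\|_k\le\|y\|_k$) with $$\|f\|_0\le\|f\|_1,\quad \|\phi\|_0\le\|\phi\|_1,\quad |\langle\phi,f\rangle|\le\|\phi\|_0\|f\|_1,\quad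 |\langle\phi,f\rangle|\le\|\phi\|_1\|f\|_0 .$$ Let $\lambda<\lambda_0$ and $\lambda'$ be real numbers, $C_0,C_1>0$, $C_0'\ge1$, $0\le T_0<T_1$, let $\eta_{\varepsilon,T}>0$ for $\varepsilon>0$, $T\ge T_1$, and let $\xi_\varepsilon,\Xi_\varepsilon>0$ for $\varepsilon\in(0,1]$ with $\xi_\varepsilon\searrow0$ and $\Xi_\varepsilon\nearrow\infty$ as $\varepsilon\searrow0$. Assume the following. 1. (Primal dissipativity) For $k=0,1$, all $f\in X$ and $t>0$, $$\|S_tf\|_k\le C_0e^{\lambda t}\|f\|_k+C_1\int_0^te^{\lambda(t-s)}\|S_sf\|_0\,ds .$$ 2. (Dual dissipativity) There are families of linear maps $V(t),W(t):Y\to Y$, $t>0$, with $$S^*_t\phi=V(t)\phi+\int_0^tW(t-s)S^*_s\phi\,ds$$ (the integrand being Bochner integrable in $Y$), $\|V(t)\phi\|_0\le C_0e^{\lambda t}\|\phi\|_0$, $\|W(t)\phi\|_1\le C_1e^{\lambda t}\|\phi\|_0$, and $W(t)\phi\ge0$ for $\phi\ge0$. 3. (Supereigenvector) There is $t_0>0$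 such that either $S_{t_0}f_0\ge e^{\lambda_0t_0}f_0$ for some $f_0\in X_+\setminus\{0\}$, or $S^*_{t_0}\phi_0\ge e^{\lambda_0t_0}\phi_0$ for some $\phi_0\in Y_+\setminus\{0\}$. 4. (Relaxed Doblin–Harris positivity) There are bounded families $(g_\varepsilon)_{\varepsilon>0}$ in $X_+$ and $(\psi_\varepsilon)_{\varepsilon>0}$ in $Y_+$, decreasing in $\varepsilon$, such that for all $\varepsilon>0$ and $T\ge T_1$ $$S_Tf\ge\eta_{\varepsilon,T}\,[S_{T_0}f]_{\psi_\varepsilon}\,g_\varepsilon\quad(f\in X_+),\qquad S^*_T\phi\ge\eta_{\varepsilon,T}\,[S^*_{T_0}\phi]_{g_\varepsilon}\,\psi_\varepsilon\quad(\phi\in Y_+).$$ 5. (Interpolation) For all $\varepsilon\in(0,1]$, $f\in X$, $\phi\in Y$, $$\|f\|_0\le\xi_\varepsilon\|f\|_1+\Xi_\varepsilon[f]_{\psi_\varepsilon},\qquad \|\phi\|_0\le\xi_\varepsilon\|\phi\|_1+\Xi_\varepsilon[\phi]_{g_\varepsilon}.$$ 6. $(X,\|\cdot\|_1)$ is complete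 and $\|S_tf\|_1\le C_0'e^{\lambda't}\|f\|_1$ for all $f\in X$, $t\ge0$. 7. Every $\|\cdot\|_1$-bounded sequence of $Y$ has a subsequence converging to an element of $Y$ in the weak topology $\sigma(Y,X)$. Then there is a unique triplet $(\lambda_1,f_1,\phi_1)\in\mathbb R\times X\times Y$ with $f_1\in D(\mathcal L)$, $\phi_1\in D(\mathcal L^*)$ and $$\mathcal Lf_1=\lambda_1f_1,\quad f_1\ge0,\quad \mathcal L^*\phi_1=\lambda_1\phi_1,\quad\phi_1\ge0,\quad\|\phi_1\|_0=1,\quad\langle\phi_1,f_1\rangle=1 .$$ Furthermore, there are constants $C\ge1$ and $\lambda_2<\lambda_1$ such that for all $f\in X$ and $t\ge0$ $$\|S_tf-\langle\phi_1,f\rangle f_1e^{\lambda_1t}\|_1\le Ce^{\lambda_2t}\,\|f-\langle\phi_1,f\rangle f_1\|_1 ,$$ where $C$ and the gap $\lambda_1-\lambda_2>0$ depend only on $\lambda,\lambda_0,\lambda',C_0,C_1,C_0',T_0,T_1$ and the functions $\eta,\xi,\Xi$, and not otherwise on the spaces, the norms or the semigroups. -/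

import Mathlib

universe u v

namespace KreinRutman

open Filter Topology Set

/-- A strongly continuous semigroup `(S t)_{t ≥ 0}` of bounded operators on a Banach space `E`.
Only the values at `t ≥ 0` matter. -/
structure C0Semigroup (E : Type*) [NormedAddCommGroup E] [NormedSpace ℝ E] where
  op : ℝ → E →L[ℝ] E
  op_zero : op 0 = ContinuousLinearMap.id ℝ E
  op_add : ∀ s t : ℝ, 0 ≤ s → 0 ≤ t → op (s + t) = (op s).comp (op t)
  continuous_orbit : ∀ x : E, ContinuousOn (fun t => op t x) (Ici 0)

namespace C0Semigroup

variable {E : Type*} [NormedAddCommGroup E] [NormedSpace ℝ E]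

/-- `x` belongs to the domain of the infinitesimal generator of `S`, and the generator maps
`x` to `y`. -/
def GeneratorMaps (S : C0Semigroup E) (x y : E) : Prop :=
  Tendsto (fun t : ℝ => t⁻¹ • (S.op t x - x)) (𝓝[>] 0) (𝓝 y)

/-- Every `S t`, `t ≥ 0`, preserves the positive cone. -/
def IsPositive [PartialOrder E] (S : C0Semigroup E) : Prop :=
  ∀ t : ℝ, 0 ≤ t → ∀ x : E, 0 ≤ x → 0 ≤ S.op t x

end C0Semigroup

/-- A lattice norm on a vector lattice `E`, not necessarily complete and not necessarily
equivalent to a given norm of `E`. -/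
structure LatticeNorm (E : Type*) [AddCommGroup E] [Module ℝ E] [Lattice E] where
  toSeminorm : Seminorm ℝ E
  eq_zero_of : ∀ x : E, toSeminorm x = 0 → x = 0
  solid : ∀ x y : E, |x| ≤ |y| → toSeminorm x ≤ toSeminorm y

namespace LatticeNorm

variable {E : Type*} [AddCommGroup E] [Module ℝ E] [Lattice E]

instance : CoeFun (LatticeNorm E) (fun _ => E → ℝ) := ⟨fun N => N.toSeminorm⟩

/-- `E` endowed with the norm `N` is a Banach space. -/
def IsBanach (N : LatticeNorm E) : Prop :=
  ∀ u : ℕ → E,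
    (∀ e : ℝ, 0 < e → ∃ n₀ : ℕ, ∀ m n : ℕ, n₀ ≤ m → n₀ ≤ n → N (u m - u n) < e) →
    ∃ x : E, Tendsto (fun n => N (u n - x)) atTop (𝓝 0)

end LatticeNorm

section

variable {X Y : Type*}
  [NormedAddCommGroup X] [Lattice X] [NormedSpace ℝ X]
  [NormedAddCommGroup Y] [Lattice Y] [NormedSpace ℝ Y]

/-- The seminorm `[f]_ψ = ⟨ψ, |f|⟩` on `X`. -/
noncomputable def bracketX (B : Y →L[ℝ] X →L[ℝ] ℝ) (ψ : Y) (f : X) : ℝ := B ψ |f|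

/-- The seminorm `[φ]_g = ⟨|φ|, g⟩` on `Y`. -/
noncomputable def bracketY (B : Y →L[ℝ] X →L[ℝ] ℝ) (g : X) (φ : Y) : ℝ := B |φ| g

/-- The bracket `B φ f = ⟨φ, f⟩` puts the ordered spaces `Y` and `X` in duality: each positive
cone is the dual cone of the other one (in particular the bracket separates the points of both
spaces, so that it embeds `Y` in `X'` and `X` in `Y'`). -/
structure OrderDuality (B : Y →L[ℝ] X →L[ℝ] ℝ) : Prop where
  nonneg_left : ∀ φ : Y, 0 ≤ φ ↔ ∀ g : X, 0 ≤ g → 0 ≤ B φ g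
  nonneg_right : ∀ f : X, 0 ≤ f ↔ ∀ ψ : Y, 0 ≤ ψ → 0 ≤ B ψ f

/-- The semigroup `Sd` on `Y` is dual to the semigroup `S` on `X`. -/
def DualSemigroups (B : Y →L[ℝ] X →L[ℝ] ℝ) (S : C0Semigroup X) (Sd : C0Semigroup Y) : Prop :=
  ∀ t : ℝ, 0 ≤ t → ∀ (φ : Y) (f : X), B φ (S.op t f) = B (Sd.op t φ) f

/-- Compatibility between the norms `‖·‖₀, ‖·‖₁` on `X` and on `Y` and the bracket. -/
structure CompatibleNorms (B : Y →L[ℝ] X →L[ℝ] ℝ)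
    (NX : Fin 2 → LatticeNorm X) (NY : Fin 2 → LatticeNorm Y) : Prop where
  le_X : ∀ f : X, NX 0 f ≤ NX 1 f
  le_Y : ∀ φ : Y, NY 0 φ ≤ NY 1 φ
  pairing_01 : ∀ (φ : Y) (f : X), |B φ f| ≤ NY 0 φ * NX 1 f
  pairing_10 : ∀ (φ : Y) (f : X), |B φ f| ≤ NY 1 φ * NX 0 f

/-- Strong dissipativity of the primal semigroup, for both norms. -/
def StronglyDissipative (lam C₀ C₁ : ℝ) (S : C0Semigroup X) (NX : Fin 2 → LatticeNorm X) : Prop :=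
  ∀ (k : Fin 2) (f : X) (t : ℝ), 0 < t →
    NX k (S.op t f) ≤ C₀ * Real.exp (lam * t) * NX k f
      + C₁ * ∫ s in (0 : ℝ)..t, Real.exp (lam * (t - s)) * NX 0 (S.op s f)

/-- Strong dissipativity of the dual semigroup, through a splitting `S* = V + W * S*`, where
`(W * S*)(t) = ∫₀ᵗ W(t - s) S*(s) ds`. -/
def DualSplitting (lam C₀ C₁ : ℝ) (Sd : C0Semigroup Y) (NY : Fin 2 → LatticeNorm Y) : Prop :=
  ∃ V W : ℝ → Y →ₗ[ℝ] Y,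
    (∀ (t : ℝ) (φ : Y), 0 < t →
      IntervalIntegrable (fun s => W (t - s) (Sd.op s φ)) MeasureTheory.volume 0 t ∧
      Sd.op t φ = V t φ + ∫ s in (0 : ℝ)..t, W (t - s) (Sd.op s φ)) ∧
    (∀ (t : ℝ) (φ : Y), 0 < t → NY 0 (V t φ) ≤ C₀ * Real.exp (lam * t) * NY 0 φ) ∧
    (∀ (t : ℝ) (φ : Y), 0 < t → NY 1 (W t φ) ≤ C₁ * Real.exp (lam * t) * NY 0 φ) ∧
    (∀ (t : ℝ) (φ : Y), 0 < t → 0 ≤ φ → 0 ≤ W t φ)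

/-- There is a nonzero nonnegative `x` with `S(t₀) x ≥ e^{lam₀ t₀} x` for some `t₀ > 0`. -/
def HasSupereigenvector {E : Type*} [NormedAddCommGroup E] [Lattice E] [NormedSpace ℝ E]
    (lam₀ : ℝ) (S : C0Semigroup E) : Prop :=
  ∃ t₀ : ℝ, 0 < t₀ ∧ ∃ x : E, 0 ≤ x ∧ x ≠ 0 ∧ Real.exp (lam₀ * t₀) • x ≤ S.op t₀ x

/-- A bounded family of nonnegative elements, indexed by `ε > 0` and decreasing in `ε`. -/
structure BoundedDecreasingFamily {E : Type*} [NormedAddCommGroup E] [Lattice E]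
    (g : ℝ → E) : Prop where
  nonneg : ∀ ε : ℝ, 0 < ε → 0 ≤ g ε
  antitone : AntitoneOn g (Ioi 0)
  bounded : ∃ M : ℝ, ∀ ε : ℝ, 0 < ε → ‖g ε‖ ≤ M

/-- The relaxed Doblin–Harris positivity conditions, primal and dual. -/
structure DoblinHarris (T₀ T₁ : ℝ) (η : ℝ → ℝ → ℝ) (B : Y →L[ℝ] X →L[ℝ] ℝ)
    (S : C0Semigroup X) (Sd : C0Semigroup Y) (g : ℝ → X) (ψ : ℝ → Y) : Prop where
  primal : ∀ (ε T : ℝ), 0 < ε → T₁ ≤ T → ∀ f : X, 0 ≤ f →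
    (η ε T * bracketX B (ψ ε) (S.op T₀ f)) • g ε ≤ S.op T f
  dual : ∀ (ε T : ℝ), 0 < ε → T₁ ≤ T → ∀ φ : Y, 0 ≤ φ →
    (η ε T * bracketY B (g ε) (Sd.op T₀ φ)) • ψ ε ≤ Sd.op T φ

/-- The interpolation conditions between the norms and the seminorms, primal and dual. -/
structure Interpolation (ξ Ξ : ℝ → ℝ) (B : Y →L[ℝ] X →L[ℝ] ℝ)
    (NX : Fin 2 → LatticeNorm X) (NY : Fin 2 → LatticeNorm Y) (g : ℝ → X) (ψ : ℝ → Y) : Prop where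
  primal : ∀ (ε : ℝ), ε ∈ Ioc (0 : ℝ) 1 → ∀ f : X,
    NX 0 f ≤ ξ ε * NX 1 f + Ξ ε * bracketX B (ψ ε) f
  dual : ∀ (ε : ℝ), ε ∈ Ioc (0 : ℝ) 1 → ∀ φ : Y,
    NY 0 φ ≤ ξ ε * NY 1 φ + Ξ ε * bracketY B (g ε) φ

/-- Exponential growth bound of the semigroup for the norm `N`. -/
def GrowthBound (lam' C₀' : ℝ) (S : C0Semigroup X) (N : LatticeNorm X) : Prop :=
  ∀ (f : X) (t : ℝ), 0 ≤ t → N (S.op t f) ≤ C₀' * Real.exp (lam' * t) * N f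

/-- Every sequence of `Y` that is bounded for the norm `N` has a subsequence that converges in
`Y` for the weak topology `σ(Y, X)`. -/
def WeaklySeqCompactBalls (B : Y →L[ℝ] X →L[ℝ] ℝ) (N : LatticeNorm Y) : Prop :=
  ∀ (u : ℕ → Y) (M : ℝ), (∀ n, N (u n) ≤ M) →
    ∃ (φ : Y) (σ : ℕ → ℕ), StrictMono σ ∧
      ∀ f : X, Tendsto (fun n => B (u (σ n)) f) atTop (𝓝 (B φ f))

/-- `(lam₁, f₁, φ₁)` is a nonnegative eigentriplet for the generators of `S` and `Sd`, normalized
by `‖φ₁‖₀ = 1` and `⟨φ₁, f₁⟩ = 1`. -/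
structure IsEigentriplet (B : Y →L[ℝ] X →L[ℝ] ℝ) (S : C0Semigroup X) (Sd : C0Semigroup Y)
    (N₀ : LatticeNorm Y) (lam₁ : ℝ) (f₁ : X) (φ₁ : Y) : Prop where
  primal : S.GeneratorMaps f₁ (lam₁ • f₁)
  primal_nonneg : 0 ≤ f₁
  dual : Sd.GeneratorMaps φ₁ (lam₁ • φ₁)
  dual_nonneg : 0 ≤ φ₁
  norm_dual : N₀ φ₁ = 1
  pairing : B φ₁ f₁ = 1

end

end KreinRutman

/-!
Fix one small `ε`, write `(g, ψ)` for `(g ε, ψ ε)`, and let `ω` be the abscissa of convergence of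
the Laplace transform `κ ↦ ∫₀^∞ e^{-κt} ⟨ψ, S_t g⟩ dt`. If the transform converges at `κ`,
interpolation and dissipativity force `e^{-κt} S*_t → 0` uniformly on the bounded part of the
positive cone. This decay is an open condition on `κ`, and a supereigenvector excludes it for
`κ ≤ lam₀`; hence `ω ≥ lam₀` and the transform diverges at `ω`. The normalised truncated transforms
`∫₀^τ e^{-κt} S*_t ψ dt`, `κ ↓ ω`, are therefore approximate eigenvectors of the dual generator. The
splitting `S* = V + W * S*` bounds them in `‖·‖₁` up to an error that is small in `‖·‖₀`, so that
weak compactness provides a limit, which interpolation shows to be nonzero.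

After rescaling by `e^{-ωt}` the limit `φ` is an invariant functional and `⟨φ, |f|⟩` is
non-increasing along the semigroup. Dissipativity and interpolation give a Lyapunov estimate for
`‖·‖₁`, and the positivity condition contracts `⟨φ, |f|⟩` on the `f ∈ ker φ` with
`‖f‖₁ ≤ A ⟨φ, |f|⟩`. Harris' argument for the norm `⟨φ, |f|⟩ + β ‖f‖₁` then yields exponential decay
on `ker φ`, with constants chosen before the spaces. Consequently the rescaled orbit of any `h` with
`⟨φ, h⟩ = 1` is Cauchy, and its limit is the primal eigenvector.
-/

namespace KreinRutman

open Filter Topology Set MeasureTheory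

/-! ### Exponential convolutions and Volterra inequalities -/

section Volterra

/-- The convolution `∫₀ᵗ exp (b (t - s)) u s ds` of `u` with an exponential kernel. -/
noncomputable def expConv (b : ℝ) (u : ℝ → ℝ) (t : ℝ) : ℝ :=
  ∫ s in (0 : ℝ)..t, Real.exp (b * (t - s)) * u s

variable {b : ℝ} {u v : ℝ → ℝ} {t : ℝ}

lemma hasDerivAt_exp_mul (b t : ℝ) :
    HasDerivAt (fun t => Real.exp (b * t)) (b * Real.exp (b * t)) t :=
  (((hasDerivAt_id' t).const_mul b).exp).congr_deriv (by ring)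

lemma expConv_eq_exp_mul_integral (b : ℝ) (u : ℝ → ℝ) (t : ℝ) :
    expConv b u t = Real.exp (b * t) * ∫ s in (0 : ℝ)..t, Real.exp (-(b * s)) * u s := by
  rw [expConv, ← intervalIntegral.integral_const_mul]
  congr 1; ext s
  rw [← mul_assoc, ← Real.exp_add]
  ring_nf

lemma exp_mul_expConv (κ b : ℝ) (u : ℝ → ℝ) (t : ℝ) :
    Real.exp (-(κ * t)) * expConv b u t
      = expConv (b - κ) (fun s => Real.exp (-(κ * s)) * u s) t := by
  rw [expConv_eq_exp_mul_integral, expConv_eq_exp_mul_integral, ← mul_assoc, ← Real.exp_add]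
  congr 1
  · ring_nf
  · congr 1; ext s
    rw [← mul_assoc, ← Real.exp_add]
    ring_nf

lemma expConv_const_mul (b c : ℝ) (u : ℝ → ℝ) (t : ℝ) :
    expConv b (fun s => c * u s) t = c * expConv b u t := by
  simp only [expConv, mul_left_comm _ c, intervalIntegral.integral_const_mul]

lemma expConv_mono {b' : ℝ} (hb : b ≤ b') (ht : 0 ≤ t) (hu : ContinuousOn u (Ici 0))
    (hv : ContinuousOn v (Ici 0)) (huv : ∀ s ∈ Icc 0 t, u s ≤ v s)
    (hv0 : ∀ s ∈ Icc 0 t, 0 ≤ v s) : expConv b u t ≤ expConv b' v t := by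
  have hint : ∀ {w : ℝ → ℝ}, ContinuousOn w (Ici 0) → IntervalIntegrable w volume 0 t :=
    fun hw => (hw.mono Icc_subset_Ici_self).intervalIntegrable_of_Icc ht
  refine intervalIntegral.integral_mono_on ht (hint (by fun_prop)) (hint (by fun_prop))
    fun s hs => ?_
  calc Real.exp (b * (t - s)) * u s ≤ Real.exp (b * (t - s)) * v s :=
        mul_le_mul_of_nonneg_left (huv s hs) (Real.exp_pos _).le
    _ ≤ Real.exp (b' * (t - s)) * v s :=
        mul_le_mul_of_nonneg_right (Real.exp_le_exp.2
          (mul_le_mul_of_nonneg_right hb (sub_nonneg.2 hs.2))) (hv0 s hs)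

lemma expConv_nonneg (b : ℝ) (ht : 0 ≤ t) (hu : ∀ s, 0 ≤ s → 0 ≤ u s) : 0 ≤ expConv b u t :=
  intervalIntegral.integral_nonneg ht fun s hs =>
    mul_nonneg (Real.exp_pos _).le (hu s hs.1)

lemma expConv_const_le {m : ℝ} (hb : b < 0) (hm : 0 ≤ m) (t : ℝ) :
    expConv b (fun _ => m) t ≤ m / -b := by
  have hint : ∫ s in (0 : ℝ)..t, Real.exp (-(b * s)) = (Real.exp (-(b * t)) - 1) / -b := by
    have hderiv : ∀ s ∈ uIcc 0 t, HasDerivAt (fun s => Real.exp (-b * s) / -b)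
        (Real.exp (-(b * s))) s := fun s _ =>
      ((hasDerivAt_exp_mul (-b) s).div_const (-b)).congr_deriv (by field_simp [hb.ne])
    rw [intervalIntegral.integral_eq_sub_of_hasDerivAt hderiv
      (Continuous.intervalIntegrable (by fun_prop) _ _), neg_mul]
    simp [sub_div]
  rw [expConv_eq_exp_mul_integral, intervalIntegral.integral_mul_const, hint]
  have hexp : Real.exp (b * t) * Real.exp (-(b * t)) = 1 := by rw [← Real.exp_add]; simp
  calc _ = (Real.exp (b * t) * Real.exp (-(b * t)) - Real.exp (b * t)) * (m / -b) := by ring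
    _ ≤ 1 * (m / -b) := by
      gcongr
      · exact div_nonneg hm (by linarith)
      · linarith [Real.exp_pos (b * t)]
    _ = m / -b := one_mul _

lemma continuousOn_primitive_Ici (hu : ContinuousOn u (Ici 0)) :
    ContinuousOn (fun t => ∫ s in (0 : ℝ)..t, u s) (Ici 0) := by
  intro t (ht : 0 ≤ t)
  have ht1 : (0 : ℝ) ≤ t + 1 := by linarith
  have hcont := intervalIntegral.continuousOn_primitive_interval'
    ((hu.mono Icc_subset_Ici_self).intervalIntegrable_of_Icc (μ := volume) ht1) left_mem_uIcc
  rw [uIcc_of_le ht1] at hcont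
  refine (hcont t ⟨ht, by linarith⟩).mono_of_mem_nhdsWithin ?_
  rw [← Ici_inter_Iic]
  exact inter_mem self_mem_nhdsWithin (mem_nhdsWithin_of_mem_nhds (Iic_mem_nhds (by linarith)))

lemma continuousOn_expConv (hu : ContinuousOn u (Ici 0)) :
    ContinuousOn (expConv b u) (Ici 0) := by
  have hprim := continuousOn_primitive_Ici (u := fun s => Real.exp (-(b * s)) * u s) (by fun_prop)
  refine ContinuousOn.congr ?_ fun t _ => expConv_eq_exp_mul_integral b u t
  fun_prop

lemma hasDerivAt_expConv (hu : ContinuousOn u (Ici 0)) (ht : 0 < t) :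
    HasDerivAt (expConv b u) (b * expConv b u t + u t) t := by
  have hcont : ContinuousOn (fun s => Real.exp (-(b * s)) * u s) (Ici 0) := by fun_prop
  have hprim : HasDerivAt (fun t => ∫ s in (0 : ℝ)..t, Real.exp (-(b * s)) * u s)
      (Real.exp (-(b * t)) * u t) t :=
    intervalIntegral.integral_hasDerivAt_right
      ((hcont.mono Icc_subset_Ici_self).intervalIntegrable_of_Icc ht.le)
      ((hcont.mono Ioi_subset_Ici_self).stronglyMeasurableAtFilter isOpen_Ioi t ht)
      (hcont.continuousAt (Ici_mem_nhds ht))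
  rw [funext (expConv_eq_exp_mul_integral b u)]
  have hexp : Real.exp (b * t) * Real.exp (-(b * t)) = 1 := by rw [← Real.exp_add]; simp
  exact ((hasDerivAt_exp_mul b t).mul hprim).congr_deriv (by linear_combination u t * hexp)

lemma nonpos_of_deriv_le_mul {d d' : ℝ → ℝ} {a : ℝ} (hcont : ContinuousOn d (Ici 0))
    (hd : ∀ t, 0 < t → HasDerivAt d (d' t) t) (hle : ∀ t, 0 < t → d' t ≤ a * d t)
    (h0 : d 0 ≤ 0) (ht : 0 ≤ t) : d t ≤ 0 := by
  have hderiv : ∀ t, 0 < t → HasDerivAt (fun t => Real.exp (-a * t) * d t)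
      (Real.exp (-a * t) * (d' t - a * d t)) t := fun t ht =>
    ((hasDerivAt_exp_mul (-a) t).mul (hd t ht)).congr_deriv (by ring)
  have hanti : AntitoneOn (fun t => Real.exp (-a * t) * d t) (Ici 0) := by
    refine antitoneOn_of_deriv_nonpos (convex_Ici 0) (by fun_prop) ?_ ?_ <;>
      rw [interior_Ici] <;> intro s hs
    · exact (hderiv s hs).differentiableAt.differentiableWithinAt
    · rw [(hderiv s hs).deriv]
      exact mul_nonpos_of_nonneg_of_nonpos (Real.exp_pos _).le (sub_nonpos.2 (hle s hs))
  have hle0 := hanti self_mem_Ici ht ht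
  simp only [mul_zero, Real.exp_zero, one_mul] at hle0
  exact nonpos_of_mul_nonpos_right (hle0.trans h0) (Real.exp_pos _)

/-- The right-hand side of the conclusion is the solution of the corresponding equality. -/
theorem volterra_inequality {c A : ℝ} {γ : ℝ → ℝ} (hc : 0 ≤ c)
    (hu : ContinuousOn u (Ici 0)) (hγ : ContinuousOn γ (Ici 0)) (hv : ContinuousOn v (Ici 0))
    (h : ∀ t, 0 < t → u t ≤ γ t + A * Real.exp (b * t) + expConv b (fun s => c * u s + v s) t) :
    ∀ t, 0 < t → u t ≤ γ t + A * Real.exp ((b + c) * t)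
      + expConv (b + c) (fun s => c * γ s + v s) t := by
  have hcu : ContinuousOn (fun s => c * u s + v s) (Ici 0) := by fun_prop
  have hcγ : ContinuousOn (fun s => c * γ s + v s) (Ici 0) := by fun_prop
  have hexp : ∀ a t : ℝ,
      HasDerivAt (fun t => A * Real.exp (a * t)) (a * (A * Real.exp (a * t))) t := fun a t =>
     ((hasDerivAt_exp_mul a t).const_mul A).congr_deriv (by ring)
  have hd : ∀ t, 0 < t → HasDerivAt (fun t => A * Real.exp (b * t) + expConv b _ t
      - (A * Real.exp ((b + c) * t) + expConv (b + c) _ t)) _ t := fun t ht =>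
    ((hexp b t).add (hasDerivAt_expConv hcu ht)).sub
      ((hexp (b + c) t).add (hasDerivAt_expConv hcγ ht))
  have hcont := (continuousOn_expConv (b := b) hcu)
  have hcont' := (continuousOn_expConv (b := b + c) hcγ)
  intro t ht
  have hcompare := nonpos_of_deriv_le_mul (a := b + c) (by fun_prop) hd (fun t ht => ?_)
    (by simp [expConv]) ht.le
  · linarith [h t ht]
  · linarith [mul_le_mul_of_nonneg_left (h t ht) hc]

lemma integrableOn_Ioi_of_integral_le {J : ℝ} (hu : ContinuousOn u (Ici 0))
    (hu0 : ∀ s, 0 ≤ s → 0 ≤ u s) (hJ : ∀ t, 0 ≤ t → ∫ s in (0 : ℝ)..t, u s ≤ J) :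
    IntegrableOn u (Ioi 0) := by
  refine integrableOn_Ioi_of_intervalIntegral_norm_bounded J 0
    (fun t : ℝ => ((hu.mono Icc_subset_Ici_self).integrableOn_Icc).mono_set Ioc_subset_Icc_self)
    tendsto_id ?_
  filter_upwards [eventually_ge_atTop 0] with t ht
  refine (intervalIntegral.integral_congr fun s hs => ?_).trans_le (hJ t ht)
  rw [id, uIcc_of_le ht] at hs
  exact Real.norm_of_nonneg (hu0 s hs.1)

lemma integral_le_integral_Ioi (hu : IntegrableOn u (Ioi 0)) (hu0 : ∀ s, 0 ≤ s → 0 ≤ u s)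
    (ht : 0 ≤ t) : ∫ s in (0 : ℝ)..t, u s ≤ ∫ s in Ioi 0, u s := by
  rw [intervalIntegral.integral_of_le ht]
  exact setIntegral_mono_set hu
    ((ae_restrict_mem measurableSet_Ioi).mono fun s hs => hu0 s (le_of_lt hs))
    Ioc_subset_Ioi_self.eventuallyLE

/-- Young's inequality, from `w' = b w + u` for `w = expConv b u`. -/
lemma integrableOn_expConv (hb : b < 0) (hu : ContinuousOn u (Ici 0))
    (hu0 : ∀ s, 0 ≤ s → 0 ≤ u s) (hint : IntegrableOn u (Ioi 0)) :
    IntegrableOn (expConv b u) (Ioi 0) := by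
  have hcont := continuousOn_expConv (b := b) hu
  refine integrableOn_Ioi_of_integral_le hcont (fun s hs => expConv_nonneg b hs hu0)
    (J := (∫ s in Ioi 0, u s) / -b) fun t ht => ?_
  have hint' : ∀ {w : ℝ → ℝ}, ContinuousOn w (Ici 0) → IntervalIntegrable w volume 0 t :=
    fun hw => (hw.mono Icc_subset_Ici_self).intervalIntegrable_of_Icc ht
  have hftc : ∫ s in (0 : ℝ)..t, (b * expConv b u s + u s) = expConv b u t := by
    rw [intervalIntegral.integral_eq_sub_of_hasDerivAt_of_le ht (hcont.mono Icc_subset_Ici_self)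
      (fun s hs => hasDerivAt_expConv hu hs.1) (hint' (by fun_prop))]
    simp [expConv]
  rw [intervalIntegral.integral_add (hint' (by fun_prop)) (hint' hu),
    intervalIntegral.integral_const_mul] at hftc
  rw [le_div_iff₀ (by linarith)]
  linarith [expConv_nonneg b ht hu0, integral_le_integral_Ioi hint hu0 ht]

lemma tendsto_exp_mul_zero (hb : b < 0) : Tendsto (fun t => Real.exp (b * t)) atTop (𝓝 0) :=
  Real.tendsto_exp_atBot.comp (tendsto_id.const_mul_atTop_of_neg hb)

lemma tendsto_expConv_zero (hb : b < 0) (hint : IntegrableOn u (Ioi 0)) :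
    Tendsto (expConv b u) atTop (𝓝 0) := by
  have hdom : Tendsto
      (fun t => ∫ s in Ioi 0, (Iic t).indicator (fun s => Real.exp (b * (t - s)) * u s) s)
      atTop (𝓝 (∫ _ in Ioi (0 : ℝ), 0)) := by
    refine tendsto_integral_filter_of_dominated_convergence (fun s => ‖u s‖) ?_ ?_ hint.norm ?_
    · exact .of_forall fun t => AEStronglyMeasurable.indicator
        (Continuous.aestronglyMeasurable (by fun_prop) |>.mul hint.aestronglyMeasurable)
        measurableSet_Iic
    · refine .of_forall fun t => .of_forall fun s => ?_
      by_cases hs : s ∈ Iic t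
      · rw [indicator_of_mem hs, norm_mul, Real.norm_of_nonneg (Real.exp_pos _).le]
        refine mul_le_of_le_one_left (norm_nonneg _) (Real.exp_le_one_iff.2 ?_)
        exact mul_nonpos_of_nonpos_of_nonneg hb.le (sub_nonneg.2 hs)
      · simp [indicator_of_notMem hs]
    · refine .of_forall fun s => ?_
      have hexp : Tendsto (fun t => Real.exp (b * (t - s)) * u s) atTop (𝓝 (0 * u s)) :=
        ((tendsto_exp_mul_zero hb).comp
          (tendsto_atTop_add_const_right _ (-s) tendsto_id)).mul_const _
      rw [zero_mul] at hexp
      refine hexp.congr' ?_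
      filter_upwards [eventually_ge_atTop s] with t ht
      rw [indicator_of_mem (mem_Iic.2 ht)]
  rw [integral_zero] at hdom
  refine hdom.congr' ?_
  filter_upwards [eventually_ge_atTop 0] with t ht
  rw [expConv, intervalIntegral.integral_of_le ht, setIntegral_indicator measurableSet_Iic,
    Ioi_inter_Iic]

end Volterra

section Contraction

lemma le_of_forall_pos_le_add_mul {a b c : ℝ} (h : ∀ e : ℝ, 0 < e → a ≤ b + e * c) : a ≤ b := by
  have hlim : Tendsto (fun e : ℝ => b + e * c) (𝓝[>] 0) (𝓝 (b + 0 * c)) :=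
    (Continuous.tendsto (by fun_prop) 0).mono_left nhdsWithin_le_nhds
  rw [zero_mul, add_zero] at hlim
  exact ge_of_tendsto hlim (eventually_mem_nhdsWithin.mono fun e he => h e he)

lemma exp_decay_of_periodic_contraction {T δ D : ℝ} {u : ℝ → ℝ} (hT : 0 < T) (hδ : 0 ≤ δ)
    (hD : 0 ≤ D) (hbd : ∀ r, 0 ≤ r → r ≤ T → u r ≤ D)
    (hstep : ∀ t, 0 ≤ t → u (t + T) ≤ Real.exp (-(δ * T)) * u t) {t : ℝ} (ht : 0 ≤ t) :
    u t ≤ D * Real.exp (δ * T) * Real.exp (-(δ * t)) := by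
  have hiter : ∀ (n : ℕ) (r : ℝ), 0 ≤ r → r ≤ T →
      u (r + n * T) ≤ Real.exp (-(δ * (n * T))) * D := by
    intro n r hr hrT
    induction n with
    | zero => simpa using hbd r hr hrT
    | succ n ih =>
      calc u (r + (n + 1 : ℕ) * T) = u (r + n * T + T) := by push_cast; ring_nf
        _ ≤ Real.exp (-(δ * T)) * u (r + n * T) := hstep _ (by positivity)
        _ ≤ Real.exp (-(δ * T)) * (Real.exp (-(δ * (n * T))) * D) := by gcongr
        _ = Real.exp (-(δ * ((n + 1 : ℕ) * T))) * D := by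
          rw [← mul_assoc, ← Real.exp_add]; push_cast; ring_nf
  have hfloor : (⌊t / T⌋₊ : ℝ) * T ≤ t := by
    rw [← le_div_iff₀ hT]; exact Nat.floor_le (by positivity)
  have hceil : t ≤ (⌊t / T⌋₊ + 1) * T := by
    rw [← div_le_iff₀ hT]; exact (Nat.lt_floor_add_one _).le
  calc u t = u (t - ⌊t / T⌋₊ * T + ⌊t / T⌋₊ * T) := by ring_nf
    _ ≤ Real.exp (-(δ * (⌊t / T⌋₊ * T))) * D := hiter _ _ (by linarith) (by linarith)
    _ ≤ Real.exp (δ * T + -(δ * t)) * D := by gcongr; nlinarith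
    _ = D * Real.exp (δ * T) * Real.exp (-(δ * t)) := by rw [Real.exp_add]; ring

/-- Harris' theorem in scalar form: `q` is an invariant seminorm and `n` a Lyapunov norm. -/
lemma harris_combination {q n q' n' K c d : ℝ} (hq : 0 ≤ q) (hn : 0 ≤ n)
    (hK : 0 ≤ K) (hc : 0 < c) (hd : d ≤ 1 / 4) (hd' : d ≤ c / (K + 1) / 4)
    (hqq : q' ≤ q) (hnn : n' ≤ 1 / 4 * n + K * q)
    (hdoblin : n ≤ (4 * K + 1) * q → q' ≤ (1 - 2 * c) * q) :
    q' + c / (K + 1) * n' ≤ (1 - d) * (q + c / (K + 1) * n) := by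
  set β := c / (K + 1) with hβ
  have hβ0 : 0 < β := by positivity
  have hβc : β * K + β = c := by rw [hβ]; field_simp
  have hβn := mul_le_mul_of_nonneg_left hnn hβ0.le
  have hdn : d * (β * n) ≤ 1 / 4 * (β * n) := by gcongr
  rcases le_total n ((4 * K + 1) * q) with h | h
  · have hβK : β * K * q ≤ c * q := by gcongr; linarith
    have hdq : d * q ≤ c * q := by gcongr; nlinarith
    linarith [hdoblin h, mul_nonneg hβ0.le hn]
  · have hqn : q ≤ n := by nlinarith
    have hdq : d * q ≤ β / 4 * n := by gcongr
    have hβKq : β * ((4 * K + 1) * q) ≤ β * n := by gcongr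
    linarith [mul_nonneg hβ0.le hq]

/-- The hypotheses of Harris' theorem with period `T` on the values `q` and `n`, along an orbit, of
an invariant seminorm and of a Lyapunov norm. -/
structure IsHarrisPair (P K T c : ℝ) (q n : ℝ → ℝ) : Prop where
  nonneg_left : ∀ t, 0 ≤ t → 0 ≤ q t
  nonneg_right : ∀ t, 0 ≤ t → 0 ≤ n t
  le_zero : q 0 ≤ n 0
  antitone : AntitoneOn q (Ici 0)
  bounded : ∀ t, 0 ≤ t → n t ≤ P * n 0 + K * q 0
  lyapunov : ∀ t, 0 ≤ t → n (t + T) ≤ 1 / 4 * n t + K * q t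
  doblin : ∀ t, 0 ≤ t → n t ≤ (4 * K + 1) * q t → q (t + T) ≤ (1 - 2 * c) * q t

lemma IsHarrisPair.exists_decay_rate {P K T c : ℝ} (hP : 0 ≤ P) (hK : 0 ≤ K) (hT : 0 < T)
    (hc : 0 < c) :
    ∃ C δ : ℝ, 1 ≤ C ∧ 0 < δ ∧ ∀ q n : ℝ → ℝ, IsHarrisPair P K T c q n →
      ∀ t, 0 ≤ t → n t ≤ C * Real.exp (-(δ * t)) * n 0 := by
  set β := c / (K + 1)
  have hβ : 0 < β := by positivity
  set d := min (1 / 4) (β / 4)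
  have hd : 0 < d := by positivity
  have hd4 : d ≤ 1 / 4 := min_le_left _ _
  set δ := -Real.log (1 - d) / T
  have hδ : 0 < δ := div_pos (neg_pos.2 (Real.log_neg (by linarith) (by linarith))) hT
  have hδT : Real.exp (-(δ * T)) = 1 - d := by
    rw [div_mul_cancel₀ _ hT.ne', neg_neg, Real.exp_log (by linarith)]
  set D := 1 + β * (P + K)
  refine ⟨max 1 (D * Real.exp (δ * T) / β), δ, le_max_left _ _, hδ, fun q n h t ht => ?_⟩
  have hn0 := h.nonneg_right 0 le_rfl
  have hdecay := exp_decay_of_periodic_contraction (u := fun t => q t + β * n t)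
    (D := D * n 0) hT hδ.le (by positivity) (fun r hr _ => ?_) (fun t ht => ?_) ht
  · have : 0 ≤ q t := h.nonneg_left t ht
    calc n t ≤ (q t + β * n t) / β := by rw [le_div_iff₀ hβ]; linarith
      _ ≤ D * n 0 * Real.exp (δ * T) * Real.exp (-(δ * t)) / β := by gcongr
      _ = D * Real.exp (δ * T) / β * Real.exp (-(δ * t)) * n 0 := by ring
      _ ≤ _ := by gcongr; exact le_max_right _ _
  · calc q r + β * n r ≤ n 0 + β * (P * n 0 + K * n 0) := by
          gcongr
          · exact (h.antitone self_mem_Ici hr hr).trans h.le_zero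
          · exact (h.bounded r hr).trans (by gcongr; exact h.le_zero)
      _ = D * n 0 := by ring
  · rw [hδT]
    exact harris_combination (h.nonneg_left t ht) (h.nonneg_right t ht) hK hc hd4
      (min_le_right _ _) (h.antitone ht (mem_Ici.2 (by linarith)) (by linarith))
      (h.lyapunov t ht) (h.doblin t ht)

end Contraction

section SeminormIntegral

variable {E : Type*} [NormedAddCommGroup E] [NormedSpace ℝ E]

lemma exists_norming_functional {p : Seminorm ℝ E} (hp : Continuous p) (x : E) :
    ∃ l : E →L[ℝ] ℝ, l x = p x ∧ ∀ y, |l y| ≤ p y := by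
  rcases eq_or_ne x 0 with rfl | hx
  · exact ⟨0, by simp, fun y => by simp⟩
  · let f : E →ₗ.[ℝ] ℝ := LinearPMap.mkSpanSingleton x (p x) hx
    have hf : ∀ y : f.domain, f.toFun y ≤ p y := by
      rintro ⟨y, hy⟩
      obtain ⟨c, rfl⟩ := Submodule.mem_span_singleton.1 hy
      have hfc : f.toFun ⟨c • x, hy⟩ = c • p x := LinearPMap.mkSpanSingleton'_apply _ _ _ _ _
      rw [hfc, map_smul_eq_mul]
      exact mul_le_mul_of_nonneg_right (le_abs_self c) (apply_nonneg p x)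
    obtain ⟨l, hl, hlp⟩ :=
      Module.Dual.exists_continuous_extension_of_le_seminorm_real f.domain f.toFun hp hf
    exact ⟨l, (hl ⟨x, Submodule.mem_span_singleton_self x⟩).trans
      (LinearPMap.mkSpanSingleton_apply _ _ hx (p x)), hlp⟩

lemma seminorm_integral_le [CompleteSpace E] {p : Seminorm ℝ E} (hp : Continuous p) {r t : ℝ}
    (hrt : r ≤ t) {F : ℝ → E} {k : ℝ → ℝ} (hF : IntervalIntegrable F volume r t)
    (hk : IntervalIntegrable k volume r t) (h : ∀ s ∈ Ioo r t, p (F s) ≤ k s) :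
    p (∫ s in r..t, F s) ≤ ∫ s in r..t, k s := by
  obtain ⟨l, hl, hle⟩ := exists_norming_functional hp (∫ s in r..t, F s)
  rw [← hl, ← ContinuousLinearMap.intervalIntegral_comp_comm l hF]
  refine intervalIntegral.integral_mono_on_of_le_Ioo hrt
    ⟨l.integrable_comp hF.1, l.integrable_comp hF.2⟩ hk fun s hs => ?_
  exact ((le_abs_self _).trans (hle _)).trans (h s hs)

end SeminormIntegral

/-! ### Lattice norms, positive semigroups and duality -/

namespace LatticeNorm

section

variable {E : Type*} [AddCommGroup E] [Module ℝ E] [Lattice E] (N : LatticeNorm E)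

lemma map_abs [IsOrderedAddMonoid E] (x : E) : N |x| = N x :=
  le_antisymm (N.solid _ _ (abs_abs x).le) (N.solid _ _ (abs_abs x).ge)

lemma mono [IsOrderedAddMonoid E] {x y : E} (hx : 0 ≤ x) (hxy : x ≤ y) : N x ≤ N y :=
  N.solid _ _ (by rwa [abs_of_nonneg hx, abs_of_nonneg (hx.trans hxy)])

lemma nonneg (x : E) : 0 ≤ N x := apply_nonneg N.toSeminorm x

lemma pos {x : E} (hx : x ≠ 0) : 0 < N x :=
  (N.nonneg x).lt_of_ne fun h => hx (N.eq_zero_of x h.symm)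

lemma map_smul_of_nonneg {c : ℝ} (hc : 0 ≤ c) (x : E) : N (c • x) = c * N x := by
  rw [map_smul_eq_mul, Real.norm_of_nonneg hc]

end

section

variable {E : Type*} [NormedAddCommGroup E] [NormedSpace ℝ E] [Lattice E] [IsOrderedAddMonoid E]
  [IsOrderedModule ℝ E] [HasSolidNorm E] [CompleteSpace E] (N : LatticeNorm E)

/-- Otherwise a series of positive vectors converges in norm although its terms have unbounded
`N`, while `N` is bounded by its value at the sum. -/
lemma exists_le_mul_norm : ∃ c : ℝ, ∀ x, N x ≤ c * ‖x‖ := by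
  by_contra! hcon
  choose x hx using fun n : ℕ => hcon ((4 : ℝ) ^ n)
  have hx0 : ∀ n, 0 < ‖x n‖ := by
    intro n
    rw [norm_pos_iff]
    rintro h
    simpa [h] using hx n
  set y : ℕ → E := fun n => (2 ^ n * ‖x n‖)⁻¹ • |x n|
  have hy0 : ∀ n, 0 ≤ y n := fun n => smul_nonneg (by positivity) (abs_nonneg _)
  have hyn : ∀ n, ‖y n‖ = (1 / 2) ^ n := by
    intro n
    rw [norm_smul, norm_abs_eq_norm, Real.norm_of_nonneg (by positivity), mul_inv, mul_assoc,
      inv_mul_cancel₀ (hx0 n).ne', mul_one, one_div, inv_pow]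
  have hsum : Summable y := .of_norm (by simp_rw [hyn]; exact summable_geometric_two)
  have hle : ∀ n, N (y n) ≤ N (∑' n, y n) := fun n =>
    N.mono (hy0 n) (hsum.le_tsum n fun m _ => hy0 m)
  have hlt : ∀ n, (2 : ℝ) ^ n ≤ N (y n) := by
    intro n
    have hpos := hx0 n
    rw [N.map_smul_of_nonneg (by positivity), map_abs, ← div_eq_inv_mul,
      le_div_iff₀ (by positivity), ← mul_assoc, ← mul_pow]
    norm_num
    exact (hx n).le
  obtain ⟨n, hn⟩ := pow_unbounded_of_one_lt (N (∑' n, y n)) one_lt_two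
  linarith [hle n, hlt n]

lemma continuous : Continuous N.toSeminorm := by
  obtain ⟨c, hc⟩ := N.exists_le_mul_norm
  refine Seminorm.continuous_of_continuousAt_zero (p := N.toSeminorm) ?_
  rw [ContinuousAt, map_zero]
  refine squeeze_zero N.nonneg hc ?_
  simpa using (Continuous.tendsto (by fun_prop) 0 : Tendsto (fun x : E => c * ‖x‖) (𝓝 0) _)

lemma continuousOn_orbit (S : C0Semigroup E) (x : E) :
    ContinuousOn (fun t => N (S.op t x)) (Ici 0) :=
  N.continuous.comp_continuousOn (S.continuous_orbit x)

end

end LatticeNorm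

namespace C0Semigroup

variable {E : Type*} [NormedAddCommGroup E] [NormedSpace ℝ E] {S : C0Semigroup E}

lemma op_zero_apply (S : C0Semigroup E) (x : E) : S.op 0 x = x := by
  rw [S.op_zero]; rfl

lemma op_add_apply (S : C0Semigroup E) {s t : ℝ} (hs : 0 ≤ s) (ht : 0 ≤ t) (x : E) :
    S.op (s + t) x = S.op s (S.op t x) := by
  rw [S.op_add s t hs ht]; rfl

lemma continuousOn_apply_orbit {F : Type*} [NormedAddCommGroup F] [NormedSpace ℝ F]
    (S : C0Semigroup E) (l : E →L[ℝ] F) (x : E) :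
    ContinuousOn (fun t => l (S.op t x)) (Ici 0) :=
  l.continuous.comp_continuousOn (S.continuous_orbit x)

lemma IsPositive.mono [PartialOrder E] [IsOrderedAddMonoid E] (hS : S.IsPositive) {t : ℝ}
    (ht : 0 ≤ t) {x y : E} (h : x ≤ y) : S.op t x ≤ S.op t y := by
  simpa only [map_sub, sub_nonneg] using hS t ht _ (sub_nonneg.2 h)

lemma IsPositive.abs_le [Lattice E] [IsOrderedAddMonoid E] (hS : S.IsPositive) {t : ℝ}
    (ht : 0 ≤ t) (x : E) : |S.op t x| ≤ S.op t |x| :=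
  abs_le'.2 ⟨hS.mono ht (le_abs_self x), by rw [← map_neg]; exact hS.mono ht (neg_le_abs x)⟩

end C0Semigroup

section Duality

variable {X Y : Type*}
  [NormedAddCommGroup X] [NormedSpace ℝ X] [Lattice X]
  [NormedAddCommGroup Y] [NormedSpace ℝ Y] [Lattice Y]
  {B : Y →L[ℝ] X →L[ℝ] ℝ} {S : C0Semigroup X} {Sd : C0Semigroup Y}

namespace OrderDuality

variable (hB : OrderDuality B)
include hB

lemma pairing_nonneg {φ : Y} {f : X} (hφ : 0 ≤ φ) (hf : 0 ≤ f) : 0 ≤ B φ f :=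
  (hB.nonneg_left φ).1 hφ f hf

lemma pairing_mono_right [IsOrderedAddMonoid X] {φ : Y} {f h : X} (hφ : 0 ≤ φ) (hf : f ≤ h) :
    B φ f ≤ B φ h := by
  simpa only [map_sub, sub_nonneg] using hB.pairing_nonneg hφ (sub_nonneg.2 hf)

lemma pairing_mono_left [IsOrderedAddMonoid Y] {φ ψ : Y} {f : X} (hφ : φ ≤ ψ) (hf : 0 ≤ f) :
    B φ f ≤ B ψ f := by
  simpa only [map_sub, _root_.sub_apply, sub_nonneg] using
    hB.pairing_nonneg (sub_nonneg.2 hφ) hf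

lemma ext_left {φ ψ : Y} [IsOrderedAddMonoid Y] (h : ∀ f, B φ f = B ψ f) : φ = ψ := by
  have hle : ∀ {φ ψ : Y}, (∀ f, B φ f = B ψ f) → φ ≤ ψ := fun {φ ψ} h => by
    rw [← sub_nonneg, hB.nonneg_left]
    simp [h]
  exact le_antisymm (hle h) (hle fun f => (h f).symm)

lemma exists_pairing_pos_right [IsOrderedAddMonoid X] {f : X} (hf : 0 ≤ f) (hf0 : f ≠ 0) :
    ∃ ψ, 0 ≤ ψ ∧ 0 < B ψ f := by
  by_contra! h
  refine hf0 (le_antisymm ?_ hf)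
  rw [← neg_nonneg, hB.nonneg_right]
  intro ψ hψ
  rw [map_neg]
  linarith [h ψ hψ]

end OrderDuality

lemma DualSemigroups.isPositive (hd : DualSemigroups B S Sd) (hB : OrderDuality B)
    (hS : S.IsPositive) : Sd.IsPositive := by
  intro t ht φ hφ
  rw [hB.nonneg_left]
  intro g hg
  rw [← hd t ht]
  exact hB.pairing_nonneg hφ (hS t ht g hg)

lemma CompatibleNorms.tendsto_pairing_zero {NX : Fin 2 → LatticeNorm X}
    {NY : Fin 2 → LatticeNorm Y} (hN : CompatibleNorms B NX NY) {ι : Type*} {l : Filter ι}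
    {u : ι → Y} (hu : Tendsto (fun i => NY 0 (u i)) l (𝓝 0)) (f : X) :
    Tendsto (fun i => B (u i) f) l (𝓝 0) :=
  squeeze_zero_norm (fun i => hN.pairing_01 (u i) f) (by simpa using hu.mul_const (NX 1 f))

end Duality

/-! ### Rescaled semigroups -/

namespace C0Semigroup

variable {E : Type*} [NormedAddCommGroup E] [NormedSpace ℝ E] {S : C0Semigroup E} {x y : E}

/-- The semigroup `exp (-κ t) S_t`, whose generator is `L - κ` if `L` is the generator of `S`.
Rescaling by an eigenvalue turns the eigenvectors into stationary vectors. -/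
noncomputable def rescale (S : C0Semigroup E) (κ : ℝ) : C0Semigroup E where
  op t := Real.exp (-(κ * t)) • S.op t
  op_zero := by simp [S.op_zero]
  op_add s t hs ht := by
    ext x
    simp only [S.op_add s t hs ht, mul_add, neg_add, Real.exp_add, ContinuousLinearMap.comp_apply,
      _root_.smul_apply, map_smul, smul_smul, mul_comm]
  continuous_orbit x := by
    have := S.continuous_orbit x
    simp only [_root_.smul_apply]
    fun_prop

lemma rescale_op_apply (S : C0Semigroup E) (κ t : ℝ) (x : E) :
    (S.rescale κ).op t x = Real.exp (-(κ * t)) • S.op t x := rfl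

lemma rescale_rescale (S : C0Semigroup E) (κ ρ : ℝ) :
    (S.rescale κ).rescale ρ = S.rescale (κ + ρ) := by
  simp only [rescale, smul_smul, ← Real.exp_add, add_mul, neg_add_rev]

lemma rescale_zero (S : C0Semigroup E) : S.rescale 0 = S := by
  simp [rescale]

lemma IsPositive.rescale [PartialOrder E] [IsOrderedModule ℝ E] (hS : S.IsPositive) (κ : ℝ) :
    (S.rescale κ).IsPositive := fun t ht x hx =>
  smul_nonneg (Real.exp_pos _).le (hS t ht x hx)

lemma GeneratorMaps.rescale (h : S.GeneratorMaps x y) (κ : ℝ) :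
    (S.rescale κ).GeneratorMaps x (y - κ • x) := by
  have hexp : Tendsto (fun t : ℝ => Real.exp (-κ * t)) (𝓝[>] 0) (𝓝 1) := by
    simpa using (Continuous.tendsto (by fun_prop) 0 :
      Tendsto (fun t => Real.exp (-κ * t)) (𝓝 0) _).mono_left nhdsWithin_le_nhds
  have hslope := ((hasDerivAt_exp_mul (-κ) 0).smul_const x).tendsto_slope_zero_right
  have hsum := (hexp.smul h).add hslope
  simp only [mul_zero, Real.exp_zero, mul_one, one_smul, zero_add, neg_smul, ← sub_eq_add_neg]
    at hsum
  refine hsum.congr fun t => ?_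
  rw [rescale_op_apply, neg_mul, smul_comm _ t⁻¹, ← smul_add, smul_sub]
  congr 1
  abel

/-- `x` is fixed by the semigroup. -/
def IsStationary (S : C0Semigroup E) (x : E) : Prop := ∀ t : ℝ, 0 ≤ t → S.op t x = x

lemma IsStationary.smul (h : S.IsStationary x) (c : ℝ) : S.IsStationary (c • x) := fun t ht => by
  rw [map_smul, h t ht]

lemma GeneratorMaps.hasDerivWithinAt_orbit (h : S.GeneratorMaps x y) {r : ℝ} (hr : 0 ≤ r) :
    HasDerivWithinAt (fun r => S.op r x) (S.op r y) (Ici r) r := by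
  rw [← hasDerivWithinAt_Ioi_iff_Ici, hasDerivWithinAt_iff_tendsto_slope' self_notMem_Ioi]
  have hshift : Tendsto (fun t : ℝ => t - r) (𝓝[>] r) (𝓝[>] 0) := by
    refine tendsto_nhdsWithin_of_tendsto_nhds_of_eventually_within _ ?_
      (eventually_mem_nhdsWithin.mono fun t ht => mem_Ioi.2 (sub_pos.2 ht))
    simpa using (Continuous.tendsto (by fun_prop) r :
      Tendsto (fun t => t - r) (𝓝 r) _).mono_left nhdsWithin_le_nhds
  refine (((S.op r).continuous.tendsto _).comp (h.comp hshift)).congr' ?_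
  filter_upwards [self_mem_nhdsWithin] with t ht
  simp only [Function.comp_apply, slope, vsub_eq_sub, map_smul, map_sub]
  rw [← S.op_add_apply hr (sub_pos.2 ht).le, add_sub_cancel]

lemma isStationary_iff_generatorMaps_zero : S.IsStationary x ↔ S.GeneratorMaps x 0 := by
  refine ⟨fun h => ?_, fun h t ht => ?_⟩
  · refine tendsto_const_nhds.congr' ?_
    filter_upwards [self_mem_nhdsWithin] with t ht
    rw [h t (le_of_lt ht), sub_self, smul_zero]
  · rw [constant_of_has_deriv_right_zero ((S.continuous_orbit x).mono Icc_subset_Ici_self)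
      (fun r hr => by simpa only [map_zero] using h.hasDerivWithinAt_orbit hr.1) t ⟨ht, le_rfl⟩,
      S.op_zero_apply]

lemma isStationary_rescale_iff {μ : ℝ} :
    (S.rescale μ).IsStationary x ↔ S.GeneratorMaps x (μ • x) := by
  rw [isStationary_iff_generatorMaps_zero]
  refine ⟨fun h => ?_, fun h => by simpa only [sub_self] using h.rescale μ⟩
  simpa only [rescale_rescale, add_neg_cancel, rescale_zero, neg_smul, zero_sub, neg_neg]
    using h.rescale (-μ)

end C0Semigroup

section Dissipativity

lemma exp_sub_mul (lam κ t : ℝ) :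
    Real.exp ((lam - κ) * t) = Real.exp (-(κ * t)) * Real.exp (lam * t) := by
  rw [← Real.exp_add]; ring_nf

lemma DualSemigroups.rescale {X Y : Type*} [NormedAddCommGroup X] [NormedSpace ℝ X]
    [NormedAddCommGroup Y] [NormedSpace ℝ Y] {B : Y →L[ℝ] X →L[ℝ] ℝ} {S : C0Semigroup X}
    {Sd : C0Semigroup Y} (hd : DualSemigroups B S Sd) (κ : ℝ) :
    DualSemigroups B (S.rescale κ) (Sd.rescale κ) := fun t ht φ f => by
  simp only [C0Semigroup.rescale_op_apply, map_smul, _root_.smul_apply, hd t ht]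

variable {X Y : Type*}
  [NormedAddCommGroup X] [NormedSpace ℝ X] [Lattice X]
  [NormedAddCommGroup Y] [NormedSpace ℝ Y] [Lattice Y]
  {S : C0Semigroup X} {Sd : C0Semigroup Y}
  {NX : Fin 2 → LatticeNorm X} {NY : Fin 2 → LatticeNorm Y} {lam lam' b C₀ C₀' C₁ : ℝ}

lemma LatticeNorm.rescale_op (N : LatticeNorm X) (S : C0Semigroup X) (κ t : ℝ) (f : X) :
    N ((S.rescale κ).op t f) = Real.exp (-(κ * t)) * N (S.op t f) :=
  N.map_smul_of_nonneg (Real.exp_pos _).le _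

lemma StronglyDissipative.rescale (h : StronglyDissipative lam C₀ C₁ S NX) (κ : ℝ) :
    StronglyDissipative (lam - κ) C₀ C₁ (S.rescale κ) NX := fun k f t ht => by
  have hconv := exp_mul_expConv κ lam (fun s => NX 0 (S.op s f)) t
  simp only [← LatticeNorm.rescale_op] at hconv
  calc NX k ((S.rescale κ).op t f) = Real.exp (-(κ * t)) * NX k (S.op t f) :=
        LatticeNorm.rescale_op _ _ _ _ _
    _ ≤ Real.exp (-(κ * t)) * (C₀ * Real.exp (lam * t) * NX k f
          + C₁ * expConv lam (fun s => NX 0 (S.op s f)) t) := by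
        gcongr; exact h k f t ht
    _ = C₀ * Real.exp ((lam - κ) * t) * NX k f
          + C₁ * expConv (lam - κ) (fun s => NX 0 ((S.rescale κ).op s f)) t := by
        rw [exp_sub_mul, ← hconv]; ring

lemma StronglyDissipative.mono [IsOrderedAddMonoid X] [IsOrderedModule ℝ X] [HasSolidNorm X]
    [CompleteSpace X] (h : StronglyDissipative lam C₀ C₁ S NX) (hb : lam ≤ b) (hC₀ : 0 ≤ C₀)
    (hC₁ : 0 ≤ C₁) : StronglyDissipative b C₀ C₁ S NX := fun k f t ht => by
  have hcont := (NX 0).continuousOn_orbit S f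
  refine (h k f t ht).trans (add_le_add ?_ (mul_le_mul_of_nonneg_left ?_ hC₁))
  · have := (NX k).nonneg f
    gcongr
  · exact expConv_mono hb ht.le hcont hcont (fun _ _ => le_rfl) fun _ _ => (NX 0).nonneg _

lemma GrowthBound.rescale {N : LatticeNorm X} (h : GrowthBound lam' C₀' S N) (κ : ℝ) :
    GrowthBound (lam' - κ) C₀' (S.rescale κ) N := fun f t ht => by
  rw [LatticeNorm.rescale_op, exp_sub_mul]
  exact (mul_le_mul_of_nonneg_left (h f t ht) (Real.exp_pos _).le).trans_eq (by ring)

lemma DualSplitting.rescale [IsOrderedModule ℝ Y] (h : DualSplitting lam C₀ C₁ Sd NY) (κ : ℝ) :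
    DualSplitting (lam - κ) C₀ C₁ (Sd.rescale κ) NY := by
  obtain ⟨V, W, hVW, hV, hW, hWpos⟩ := h
  have hkernel : ∀ (t : ℝ) (φ : Y) (s : ℝ),
      (Real.exp (-(κ * (t - s))) • W (t - s)) ((Sd.rescale κ).op s φ)
        = Real.exp (-(κ * t)) • W (t - s) (Sd.op s φ) := fun t φ s => by
    rw [C0Semigroup.rescale_op_apply, LinearMap.smul_apply, map_smul, smul_smul, ← Real.exp_add]
    ring_nf
  refine ⟨fun t => Real.exp (-(κ * t)) • V t, fun t => Real.exp (-(κ * t)) • W t,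
    fun t φ ht => ?_, fun t φ ht => ?_, fun t φ ht => ?_, fun t φ ht hφ => ?_⟩
  · simp only [hkernel, intervalIntegral.integral_smul]
    refine ⟨(hVW t φ ht).1.smul _, ?_⟩
    rw [C0Semigroup.rescale_op_apply, (hVW t φ ht).2, smul_add]
    rfl
  · rw [LinearMap.smul_apply, LatticeNorm.map_smul_of_nonneg _ (Real.exp_pos _).le, exp_sub_mul]
    exact (mul_le_mul_of_nonneg_left (hV t φ ht) (Real.exp_pos _).le).trans_eq (by ring)
  · rw [LinearMap.smul_apply, LatticeNorm.map_smul_of_nonneg _ (Real.exp_pos _).le, exp_sub_mul]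
    exact (mul_le_mul_of_nonneg_left (hW t φ ht) (Real.exp_pos _).le).trans_eq (by ring)
  · exact smul_nonneg (Real.exp_pos _).le (hWpos t φ ht hφ)

lemma DualSplitting.mono (h : DualSplitting lam C₀ C₁ Sd NY) (hb : lam ≤ b) (hC₀ : 0 ≤ C₀)
    (hC₁ : 0 ≤ C₁) : DualSplitting b C₀ C₁ Sd NY := by
  obtain ⟨V, W, hVW, hV, hW, hWpos⟩ := h
  refine ⟨V, W, hVW, fun t φ ht => (hV t φ ht).trans ?_, fun t φ ht => (hW t φ ht).trans ?_,
    hWpos⟩ <;>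
  · have := (NY 0).nonneg φ
    gcongr

/-- Duhamel's formula splits an orbit into a part that is small for `‖·‖₀` and a nonnegative part
that is controlled for `‖·‖₁`. -/
lemma DualSplitting.exists_decomposition [IsOrderedAddMonoid Y] [IsOrderedModule ℝ Y]
    [HasSolidNorm Y] [CompleteSpace Y] (h : DualSplitting lam C₀ C₁ Sd NY) (hSd : Sd.IsPositive)
    {φ : Y} (hφ : 0 ≤ φ) {t : ℝ} (ht : 0 < t) :
    ∃ w : Y, 0 ≤ w ∧ NY 0 (Sd.op t φ - w) ≤ C₀ * Real.exp (lam * t) * NY 0 φ ∧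
      NY 1 w ≤ C₁ * expConv lam (fun s => NY 0 (Sd.op s φ)) t := by
  obtain ⟨V, W, hVW, hV, hW, hWpos⟩ := h
  obtain ⟨hint, heq⟩ := hVW t φ ht
  have hcont := ((NY 0).continuousOn_orbit Sd φ).mono (Icc_subset_Ici_self : Icc 0 t ⊆ Ici 0)
  refine ⟨∫ s in (0 : ℝ)..t, W (t - s) (Sd.op s φ), ?_, ?_, ?_⟩
  · rw [intervalIntegral.integral_of_le ht.le, integral_Ioc_eq_integral_Ioo]
    refine integral_nonneg_of_ae ((ae_restrict_mem measurableSet_Ioo).mono fun s hs => ?_)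
    exact hWpos _ _ (sub_pos.2 hs.2) (hSd s hs.1.le φ hφ)
  · rw [sub_eq_of_eq_add heq]
    exact hV t φ ht
  · rw [expConv, ← intervalIntegral.integral_const_mul]
    refine seminorm_integral_le (NY 1).continuous ht.le hint
      (ContinuousOn.intervalIntegrable_of_Icc ht.le (by fun_prop)) fun s hs => ?_
    rw [← mul_assoc]
    exact hW _ _ (sub_pos.2 hs.2)

lemma isStationary_rescale_of_tendsto_pairing [IsOrderedAddMonoid Y]
    {B : Y →L[ℝ] X →L[ℝ] ℝ} {φ : Y} (hB : OrderDuality B)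
    (hd : DualSemigroups B S Sd) (hN : CompatibleNorms B NX NY) {ω : ℝ} {κ : ℕ → ℝ} {u : ℕ → Y}
    (hκ : Tendsto κ atTop (𝓝 ω)) (hu : ∀ f, Tendsto (fun n => B (u n) f) atTop (𝓝 (B φ f)))
    (happ : ∀ t, 0 ≤ t →
      Tendsto (fun n => NY 0 ((Sd.rescale (κ n)).op t (u n) - u n)) atTop (𝓝 0)) :
    (Sd.rescale ω).IsStationary φ := fun t ht => by
  have hpairing : ∀ (κ : ℝ) (φ : Y) (f : X),
      B ((Sd.rescale κ).op t φ) f = Real.exp (-(κ * t)) * B φ (S.op t f) := fun κ φ f => by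
    rw [C0Semigroup.rescale_op_apply, map_smul, _root_.smul_apply, smul_eq_mul, hd t ht]
  refine hB.ext_left fun f => tendsto_nhds_unique (?_ : Tendsto
    (fun n => B ((Sd.rescale (κ n)).op t (u n)) f) atTop _) ?_
  · simp only [hpairing]
    exact (Real.continuous_exp.continuousAt.tendsto.comp (hκ.mul_const t).neg).mul (hu (S.op t f))
  · simpa using (hN.tendsto_pairing_zero (happ t ht) f).add (hu f)

end Dissipativity

/-! ### Stability and finite potentials -/

section Potential

variable {X Y : Type*} [NormedAddCommGroup X] [NormedSpace ℝ X] [NormedAddCommGroup Y]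
  [NormedSpace ℝ Y] {B : Y →L[ℝ] X →L[ℝ] ℝ} {S : C0Semigroup X} {g : X} {ψ : Y}

/-- The potential `∫₀^∞ ⟨ψ, S_t g⟩ dt` of `g`, tested against `ψ`, is finite. It is the value at
`0` of the Laplace transform of `t ↦ ⟨ψ, S_t g⟩`, the other values being obtained by rescaling. -/
def FinitePotential (B : Y →L[ℝ] X →L[ℝ] ℝ) (S : C0Semigroup X) (ψ : Y) (g : X) : Prop :=
  IntegrableOn (fun t => B ψ (S.op t g)) (Ioi 0)

lemma finitePotential_rescale_of_le {D a ρ : ℝ}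
    (hbd : ∀ t, 0 ≤ t → |B ψ (S.op t g)| ≤ D * Real.exp (a * t)) (hρ : a < ρ) :
    FinitePotential B (S.rescale ρ) ψ g := by
  refine Integrable.mono' ((integrableOn_exp_mul_Ioi (sub_neg.2 hρ) 0).const_mul D)
    ((((S.rescale ρ).continuousOn_apply_orbit (B ψ) g).mono
      Ioi_subset_Ici_self).aestronglyMeasurable measurableSet_Ioi)
    ((ae_restrict_mem measurableSet_Ioi).mono fun t (ht : 0 < t) => ?_)
  rw [C0Semigroup.rescale_op_apply, map_smul, smul_eq_mul, norm_mul,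
    Real.norm_of_nonneg (Real.exp_pos _).le, exp_sub_mul, mul_left_comm]
  exact mul_le_mul_of_nonneg_left (hbd t ht.le) (Real.exp_pos _).le

end Potential

section Stability

/-- `S_t` tends to `0` as `t → ∞` for the norm `N`, uniformly on the positive cone. -/
def C0Semigroup.StableOnCone {E : Type*} [NormedAddCommGroup E] [NormedSpace ℝ E] [Lattice E]
    (S : C0Semigroup E) (N : LatticeNorm E) : Prop :=
  ∀ e : ℝ, 0 < e → ∃ t₀ : ℝ, 0 ≤ t₀ ∧ ∀ x : E, 0 ≤ x → ∀ t, t₀ ≤ t → N (S.op t x) ≤ e * N x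

variable {X Y : Type*}
  [NormedAddCommGroup X] [NormedSpace ℝ X] [Lattice X]
  [NormedAddCommGroup Y] [NormedSpace ℝ Y] [Lattice Y]

variable {B : Y →L[ℝ] X →L[ℝ] ℝ} {S : C0Semigroup X} {Sd : C0Semigroup Y}
  {NX : Fin 2 → LatticeNorm X} {NY : Fin 2 → LatticeNorm Y} {b C₀ C₁ x Ξ₀ : ℝ} {g : X} {ψ : Y}

section Primal

variable [IsOrderedAddMonoid X] [IsOrderedModule ℝ X] [HasSolidNorm X] [CompleteSpace X]

lemma StronglyDissipative.orbit_le (hdiss : StronglyDissipative b C₀ C₁ S NX) (hC₁ : 0 ≤ C₁)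
    (hx : 0 ≤ x) {f : X} {v : ℝ → ℝ} (hv : ContinuousOn v (Ici 0))
    (hint : ∀ s, 0 ≤ s → NX 0 (S.op s f) ≤ x * NX 1 (S.op s f) + v s) {t : ℝ} (ht : 0 < t) :
    NX 1 (S.op t f) ≤ C₀ * NX 1 f * Real.exp ((b + C₁ * x) * t)
      + expConv (b + C₁ * x) (fun s => C₁ * v s) t := by
  have hcont k := (NX k).continuousOn_orbit S f
  have hvolterra : ∀ t, 0 < t → NX 1 (S.op t f) ≤ 0 + C₀ * NX 1 f * Real.exp (b * t)
      + expConv b (fun s => C₁ * x * NX 1 (S.op s f) + C₁ * v s) t := fun t ht => by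
    have hconv : C₁ * expConv b (fun s => NX 0 (S.op s f)) t
        ≤ expConv b (fun s => C₁ * x * NX 1 (S.op s f) + C₁ * v s) t := by
      rw [← expConv_const_mul]
      have hle : ∀ s ∈ Icc 0 t,
          C₁ * NX 0 (S.op s f) ≤ C₁ * x * NX 1 (S.op s f) + C₁ * v s := fun s hs =>
        (mul_le_mul_of_nonneg_left (hint s hs.1) hC₁).trans_eq (by ring)
      exact expConv_mono le_rfl ht.le ((hcont 0).const_mul C₁)
        (((hcont 1).const_mul _).add (hv.const_mul C₁)) hle
        fun s hs => (mul_nonneg hC₁ ((NX 0).nonneg _)).trans (hle s hs)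
    exact (hdiss 1 f t ht).trans (add_le_add (by linarith) hconv)
  simpa only [mul_zero, zero_add] using volterra_inequality (γ := fun _ => 0)
    (mul_nonneg hC₁ hx) (hcont 1) continuousOn_const (hv.const_mul C₁) hvolterra t ht

lemma FinitePotential.orbit_decay (hfin : FinitePotential B S ψ g) (hB : OrderDuality B)
    (hS : S.IsPositive) (hdiss : StronglyDissipative b C₀ C₁ S NX) (hC₁ : 0 ≤ C₁)
    (hg : 0 ≤ g) (hψ : 0 ≤ ψ) (hx : 0 ≤ x) (hΞ₀ : 0 ≤ Ξ₀)
    (hint : ∀ f, NX 0 f ≤ x * NX 1 f + Ξ₀ * bracketX B ψ f) (hb : b + C₁ * x < 0) :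
    IntegrableOn (fun t => NX 1 (S.op t g)) (Ioi 0) ∧
      Tendsto (fun t => NX 1 (S.op t g)) atTop (𝓝 0) := by
  set v : ℝ → ℝ := fun s => C₁ * (Ξ₀ * B ψ (S.op s g))
  have hv : ContinuousOn v (Ici 0) :=
    ((S.continuousOn_apply_orbit (B ψ) g).const_mul Ξ₀).const_mul C₁
  have hv0 : ∀ s, 0 ≤ s → 0 ≤ v s := fun s hs =>
    mul_nonneg hC₁ (mul_nonneg hΞ₀ (hB.pairing_nonneg hψ (hS s hs g hg)))
  have hvint : IntegrableOn v (Ioi 0) := (hfin.const_mul Ξ₀).const_mul C₁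
  have hle : ∀ t, 0 < t → NX 1 (S.op t g) ≤ C₀ * NX 1 g * Real.exp ((b + C₁ * x) * t)
      + expConv (b + C₁ * x) v t := fun t ht =>
    hdiss.orbit_le hC₁ hx ((S.continuousOn_apply_orbit (B ψ) g).const_mul Ξ₀)
      (fun s hs => by simpa only [bracketX, abs_of_nonneg (hS s hs g hg)] using hint (S.op s g)) ht
  constructor
  · refine Integrable.mono' (((integrableOn_exp_mul_Ioi hb 0).const_mul (C₀ * NX 1 g)).add
      (integrableOn_expConv hb hv hv0 hvint))
      ((((NX 1).continuousOn_orbit S g).mono Ioi_subset_Ici_self).aestronglyMeasurable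
        measurableSet_Ioi)
      ((ae_restrict_mem measurableSet_Ioi).mono fun t ht => ?_)
    rw [Real.norm_of_nonneg ((NX 1).nonneg _)]
    exact hle t ht
  · refine tendsto_of_tendsto_of_tendsto_of_le_of_le' tendsto_const_nhds ?_
      (.of_forall fun t => (NX 1).nonneg _) ((eventually_gt_atTop 0).mono hle)
    simpa using ((tendsto_exp_mul_zero hb).const_mul (C₀ * NX 1 g)).add
      (tendsto_expConv_zero hb hvint)

end Primal

section Dual

variable [IsOrderedAddMonoid Y] [IsOrderedModule ℝ Y] [HasSolidNorm Y] [CompleteSpace Y]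

lemma DualSplitting.orbit_le (hsplit : DualSplitting b C₀ C₁ Sd NY)
    (hSd : Sd.IsPositive) (hd : DualSemigroups B S Sd) (hN : CompatibleNorms B NX NY) (hx : 0 ≤ x)
    (hΞ₀ : 0 ≤ Ξ₀) (hint : ∀ φ, NY 0 φ ≤ x * NY 1 φ + Ξ₀ * bracketY B g φ) {φ : Y} (hφ : 0 ≤ φ)
    {t : ℝ} (ht : 0 < t) :
    NY 0 (Sd.op t φ) ≤ Ξ₀ * NY 0 φ * NX 1 (S.op t g)
      + C₀ * (1 + Ξ₀ * NX 1 g) * NY 0 φ * Real.exp (b * t)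
      + expConv b (fun s => C₁ * x * NY 0 (Sd.op s φ)) t := by
  obtain ⟨w, hw, hw0, hw1⟩ := hsplit.exists_decomposition hSd hφ ht
  have hpairing : B w g ≤ NY 0 φ * NX 1 (S.op t g) + NY 0 (Sd.op t φ - w) * NX 1 g := by
    have hsub : B w g = B φ (S.op t g) - B (Sd.op t φ - w) g := by
      rw [hd t ht.le, map_sub, _root_.sub_apply]; ring
    have := (abs_le.1 (hN.pairing_01 φ (S.op t g))).2
    have := (abs_le.1 (hN.pairing_01 (Sd.op t φ - w) g)).1
    linarith
  have hinterp : NY 0 w ≤ x * NY 1 w + Ξ₀ * B w g := by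
    simpa only [bracketY, abs_of_nonneg hw] using hint w
  have : 0 ≤ NX 1 g := (NX 1).nonneg g
  rw [expConv_const_mul]
  calc NY 0 (Sd.op t φ) = NY 0 (Sd.op t φ - w + w) := by rw [sub_add_cancel]
    _ ≤ NY 0 (Sd.op t φ - w) + (x * NY 1 w + Ξ₀ * B w g) :=
      (map_add_le_add _ _ _).trans (add_le_add_right hinterp _)
    _ ≤ NY 0 (Sd.op t φ - w) + (x * (C₁ * expConv b (fun s => NY 0 (Sd.op s φ)) t)
          + Ξ₀ * (NY 0 φ * NX 1 (S.op t g) + NY 0 (Sd.op t φ - w) * NX 1 g)) := by gcongr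
    _ = Ξ₀ * NY 0 φ * NX 1 (S.op t g) + (1 + Ξ₀ * NX 1 g) * NY 0 (Sd.op t φ - w)
          + C₁ * x * expConv b (fun s => NY 0 (Sd.op s φ)) t := by ring
    _ ≤ Ξ₀ * NY 0 φ * NX 1 (S.op t g)
          + (1 + Ξ₀ * NX 1 g) * (C₀ * Real.exp (b * t) * NY 0 φ)
          + C₁ * x * expConv b (fun s => NY 0 (Sd.op s φ)) t := by gcongr
    _ = _ := by ring

lemma FinitePotential.stableOnCone [IsOrderedAddMonoid X] [IsOrderedModule ℝ X] [HasSolidNorm X]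
    [CompleteSpace X] (hfin : FinitePotential B S ψ g) (hB : OrderDuality B) (hS : S.IsPositive)
    (hd : DualSemigroups B S Sd) (hN : CompatibleNorms B NX NY)
    (hdiss : StronglyDissipative b C₀ C₁ S NX) (hsplit : DualSplitting b C₀ C₁ Sd NY)
    (hC₁ : 0 ≤ C₁) (hg : 0 ≤ g) (hψ : 0 ≤ ψ) (hx : 0 ≤ x) (hΞ₀ : 0 ≤ Ξ₀)
    (hintX : ∀ f, NX 0 f ≤ x * NX 1 f + Ξ₀ * bracketX B ψ f)
    (hintY : ∀ φ, NY 0 φ ≤ x * NY 1 φ + Ξ₀ * bracketY B g φ) (hb : b + C₁ * x < 0) :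
    Sd.StableOnCone (NY 0) := by
  obtain ⟨hnint, hnlim⟩ := hfin.orbit_decay hB hS hdiss hC₁ hg hψ hx hΞ₀ hintX hb
  have hncont := (NX 1).continuousOn_orbit S g
  set n : ℝ → ℝ := fun t => NX 1 (S.op t g)
  set r : ℝ → ℝ := fun t => Ξ₀ * n t + C₀ * (1 + Ξ₀ * NX 1 g) * Real.exp ((b + C₁ * x) * t)
    + C₁ * x * Ξ₀ * expConv (b + C₁ * x) n t
  have hr : Tendsto r atTop (𝓝 0) := by
    simpa using ((hnlim.const_mul Ξ₀).add ((tendsto_exp_mul_zero hb).const_mul _)).add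
      ((tendsto_expConv_zero hb hnint).const_mul (C₁ * x * Ξ₀))
  have hle : ∀ φ, 0 ≤ φ → ∀ t, 0 < t → NY 0 (Sd.op t φ) ≤ r t * NY 0 φ := fun φ hφ t ht => by
    refine (volterra_inequality (v := fun _ => 0) (mul_nonneg hC₁ hx)
      ((NY 0).continuousOn_orbit Sd φ) (hncont.const_mul _) continuousOn_const (fun t ht => by
        simpa only [add_zero] using hsplit.orbit_le
          (hd.isPositive hB hS) hd hN hx hΞ₀ hintY hφ ht) t ht).trans_eq ?_
    have hfactor : expConv (b + C₁ * x) (fun s => C₁ * x * (Ξ₀ * NY 0 φ * n s) + 0) t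
        = C₁ * x * Ξ₀ * NY 0 φ * expConv (b + C₁ * x) n t := by
      rw [← expConv_const_mul]
      simp only [add_zero, mul_assoc]
    rw [hfactor]
    ring
  intro e he
  obtain ⟨t₀, ht₀⟩ := eventually_atTop.1 ((hr.eventually_le_const he).and (eventually_gt_atTop 0))
  refine ⟨t₀, (ht₀ t₀ le_rfl).2.le, fun φ hφ t ht => (hle φ hφ t (ht₀ t ht).2).trans ?_⟩
  exact mul_le_mul_of_nonneg_right (ht₀ t ht).1 ((NY 0).nonneg φ)

end Dual

lemma C0Semigroup.IsPositive.le_op_nat_mul [IsOrderedAddMonoid X] (hS : S.IsPositive)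
    {t₀ : ℝ} (ht₀ : 0 ≤ t₀) {f : X} (h : f ≤ S.op t₀ f) (n : ℕ) : f ≤ S.op (n * t₀) f := by
  induction n with
  | zero => simp [S.op_zero]
  | succ n ih =>
    rw [Nat.cast_succ, add_one_mul, add_comm, S.op_add_apply ht₀ (by positivity)]
    exact h.trans (hS.mono ht₀ ih)

lemma HasSupereigenvector.exists_le_op_rescale [IsOrderedModule ℝ X] [IsOrderedAddMonoid X]
    {lam₀ κ : ℝ} (h : HasSupereigenvector lam₀ S) (hκ : κ ≤ lam₀) :
    ∃ t₀ : ℝ, 0 < t₀ ∧ ∃ f : X, 0 ≤ f ∧ f ≠ 0 ∧ f ≤ (S.rescale κ).op t₀ f := by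
  obtain ⟨t₀, ht₀, f, hf, hf0, hfS⟩ := h
  refine ⟨t₀, ht₀, f, hf, hf0, ?_⟩
  calc f ≤ Real.exp ((lam₀ - κ) * t₀) • f :=
        le_smul_of_one_le_left hf (Real.one_le_exp (mul_nonneg (sub_nonneg.2 hκ) ht₀.le))
    _ = Real.exp (-(κ * t₀)) • Real.exp (lam₀ * t₀) • f := by rw [exp_sub_mul, mul_smul]
    _ ≤ (S.rescale κ).op t₀ f := smul_le_smul_of_nonneg_left hfS (Real.exp_pos _).le

lemma C0Semigroup.StableOnCone.lt_of_hasSupereigenvector [IsOrderedAddMonoid X]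
    [IsOrderedModule ℝ X] {N : LatticeNorm X} {lam₀ κ : ℝ}
    (hstab : (S.rescale κ).StableOnCone N) (hS : S.IsPositive) (h : HasSupereigenvector lam₀ S) :
    lam₀ < κ := by
  by_contra! hκ
  obtain ⟨t₀, ht₀, f, hf, hf0, hfS⟩ := h.exists_le_op_rescale hκ
  obtain ⟨t₁, -, hsmall⟩ := hstab (1 / 2) (by norm_num)
  obtain ⟨n, hn⟩ := exists_nat_ge (t₁ / t₀)
  have := N.mono hf ((hS.rescale κ).le_op_nat_mul ht₀.le hfS n)
  linarith [hsmall f hf _ ((div_le_iff₀ ht₀).1 hn), N.pos hf0]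

lemma C0Semigroup.StableOnCone.lt_of_hasSupereigenvector_dual [IsOrderedAddMonoid X]
    [IsOrderedModule ℝ X] {lam₀ κ : ℝ} (hstab : (Sd.rescale κ).StableOnCone (NY 0))
    (hB : OrderDuality B) (hS : S.IsPositive) (hd : DualSemigroups B S Sd)
    (hN : CompatibleNorms B NX NY) (h : HasSupereigenvector lam₀ S) : lam₀ < κ := by
  by_contra! hκ
  obtain ⟨t₀, ht₀, f, hf, hf0, hfS⟩ := h.exists_le_op_rescale hκ
  obtain ⟨ψ, hψ, hpos⟩ := hB.exists_pairing_pos_right hf hf0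
  refine hpos.not_ge (le_of_forall_pos_le_add_mul (b := 0) (c := NY 0 ψ * NX 1 f) fun e he => ?_)
  obtain ⟨t₁, -, hsmall⟩ := hstab e he
  obtain ⟨n, hn⟩ := exists_nat_ge (t₁ / t₀)
  calc B ψ f ≤ B ψ ((S.rescale κ).op (n * t₀) f) :=
        hB.pairing_mono_right hψ ((hS.rescale κ).le_op_nat_mul ht₀.le hfS n)
    _ = B ((Sd.rescale κ).op (n * t₀) ψ) f := hd.rescale κ _ (by positivity) ψ f
    _ ≤ NY 0 ((Sd.rescale κ).op (n * t₀) ψ) * NX 1 f := (le_abs_self _).trans (hN.pairing_01 _ _)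
    _ ≤ e * NY 0 ψ * NX 1 f :=
      mul_le_mul_of_nonneg_right (hsmall ψ hψ _ ((div_le_iff₀ ht₀).1 hn)) ((NX 1).nonneg f)
    _ = 0 + e * (NY 0 ψ * NX 1 f) := by ring

lemma C0Semigroup.StableOnCone.exists_exp_decay [IsOrderedAddMonoid X] [IsOrderedModule ℝ X]
    [HasSolidNorm X] [CompleteSpace X] {N : LatticeNorm X} (hstab : S.StableOnCone N)
    (hS : S.IsPositive) :
    ∃ δ : ℝ, 0 < δ ∧ ∀ f : X, 0 ≤ f → ∃ D : ℝ, ∀ t, 0 ≤ t →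
      N (S.op t f) ≤ D * Real.exp (-(δ * t)) := by
  obtain ⟨t₀, -, hsmall⟩ := hstab (Real.exp (-1)) (Real.exp_pos _)
  set T := max t₀ 1
  have hT : 0 < T := lt_max_of_lt_right one_pos
  refine ⟨T⁻¹, inv_pos.2 hT, fun f hf => ?_⟩
  obtain ⟨D, hD⟩ := isCompact_Icc.bddAbove_image
    ((N.continuousOn_orbit S f).mono (Icc_subset_Ici_self : Icc 0 T ⊆ Ici 0))
  have hbd : ∀ r, 0 ≤ r → r ≤ T → N (S.op r f) ≤ D := fun r h0 h1 => hD ⟨r, ⟨h0, h1⟩, rfl⟩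
  refine ⟨_, fun t ht => exp_decay_of_periodic_contraction hT (inv_pos.2 hT).le
    ((N.nonneg _).trans (hbd 0 le_rfl hT.le)) hbd (fun t ht => ?_) ht⟩
  rw [inv_mul_cancel₀ hT.ne', add_comm, S.op_add_apply hT.le ht]
  exact hsmall _ (hS t ht f hf) T (le_max_left _ _)

end Stability

/-! ### The dual eigenvector -/

section ApproximateEigenvectors

namespace C0Semigroup

variable {E : Type*} [NormedAddCommGroup E] [NormedSpace ℝ E] {S : C0Semigroup E} {x : E}
  {s τ : ℝ}

lemma intervalIntegrable_orbit (S : C0Semigroup E) (x : E) (hs : 0 ≤ s) (hsτ : s ≤ τ) :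
    IntervalIntegrable (fun t => S.op t x) volume s τ :=
  ((S.continuous_orbit x).mono fun _ ht => hs.trans ht.1).intervalIntegrable_of_Icc hsτ

lemma op_integral_sub [CompleteSpace E] (S : C0Semigroup E) (x : E) (hs : 0 ≤ s) (hτ : 0 ≤ τ) :
    S.op s (∫ t in (0 : ℝ)..τ, S.op t x) - ∫ t in (0 : ℝ)..τ, S.op t x
      = (∫ t in τ..(τ + s), S.op t x) - ∫ t in (0 : ℝ)..s, S.op t x := by
  have hint {r t : ℝ} (hr : 0 ≤ r) (hrt : r ≤ t) := S.intervalIntegrable_orbit x hr hrt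
  have hshift : S.op s (∫ t in (0 : ℝ)..τ, S.op t x) = ∫ t in s..(τ + s), S.op t x := by
    have htranslate := intervalIntegral.integral_comp_add_right (a := 0) (b := τ)
      (fun t => S.op t x) s
    rw [zero_add] at htranslate
    rw [← ContinuousLinearMap.intervalIntegral_comp_comm _ (hint le_rfl hτ), ← htranslate]
    refine intervalIntegral.integral_congr fun t ht => ?_
    rw [uIcc_of_le hτ] at ht
    simp only [add_comm t s, S.op_add_apply hs ht.1]
  have hs_split := intervalIntegral.integral_add_adjacent_intervals (hint le_rfl hs)
    (hint hs (by linarith : s ≤ τ + s))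
  have hτ_split := intervalIntegral.integral_add_adjacent_intervals (hint le_rfl hτ)
    (hint hτ (by linarith : τ ≤ τ + s))
  rw [hshift, sub_eq_sub_iff_add_eq_add, add_comm, hs_split, ← hτ_split, add_comm]

lemma IsPositive.integral_nonneg [Lattice E] [IsOrderedAddMonoid E] [IsOrderedModule ℝ E]
    [HasSolidNorm E] (hS : S.IsPositive) (hx : 0 ≤ x) (hτ : 0 ≤ τ) :
    0 ≤ ∫ t in (0 : ℝ)..τ, S.op t x := by
  rw [intervalIntegral.integral_of_le hτ]
  exact integral_nonneg_of_ae ((ae_restrict_mem measurableSet_Ioc).mono fun t ht =>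
    hS t ht.1.le x hx)

end C0Semigroup

lemma LatticeNorm.op_integral_sub_le {E : Type*} [NormedAddCommGroup E] [NormedSpace ℝ E]
    [Lattice E] [IsOrderedAddMonoid E] [IsOrderedModule ℝ E] [HasSolidNorm E] [CompleteSpace E]
    (N : LatticeNorm E) (S : C0Semigroup E) {x : E} {s τ D : ℝ} (hs : 0 ≤ s) (hτ : 0 ≤ τ)
    (hfirst : ∀ t, 0 ≤ t → t ≤ s → N (S.op t x) ≤ D) (hlast : ∀ t, τ ≤ t → N (S.op t x) ≤ D) :
    N (S.op s (∫ t in (0 : ℝ)..τ, S.op t x) - ∫ t in (0 : ℝ)..τ, S.op t x) ≤ 2 * (s * D) := by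
  have hbound : ∀ r, 0 ≤ r → (∀ t ∈ Ioo r (r + s), N (S.op t x) ≤ D) →
      N (∫ t in r..(r + s), S.op t x) ≤ s * D := fun r hr hbd => by
    simpa using seminorm_integral_le N.continuous (by linarith : r ≤ r + s)
      (S.intervalIntegrable_orbit x hr (by linarith)) intervalIntegrable_const hbd
  have h0 := hbound 0 le_rfl fun t ht => hfirst t ht.1.le (by linarith [ht.2])
  rw [zero_add] at h0
  rw [S.op_integral_sub x hs hτ]
  linarith [map_sub_le_add N.toSeminorm (∫ t in τ..(τ + s), S.op t x)
    (∫ t in (0 : ℝ)..s, S.op t x), hbound τ hτ fun t ht => hlast t ht.1.le]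

lemma LatticeNorm.map_inv_smul_self {E : Type*} [AddCommGroup E] [Module ℝ E] [Lattice E]
    (N : LatticeNorm E) {x : E} (hx : 0 < N x) : N ((N x)⁻¹ • x) = 1 := by
  rw [N.map_smul_of_nonneg (inv_nonneg.2 hx.le), inv_mul_cancel₀ hx.ne']

lemma DualSemigroups.pairing_integral {X Y : Type*} [NormedAddCommGroup X] [NormedSpace ℝ X]
    [NormedAddCommGroup Y] [NormedSpace ℝ Y] [CompleteSpace Y] {B : Y →L[ℝ] X →L[ℝ] ℝ}
    {S : C0Semigroup X} {Sd : C0Semigroup Y} (hd : DualSemigroups B S Sd) (ψ : Y) (g : X) {τ : ℝ}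
    (hτ : 0 ≤ τ) :
    B (∫ t in (0 : ℝ)..τ, Sd.op t ψ) g = ∫ t in (0 : ℝ)..τ, B ψ (S.op t g) := by
  refine (ContinuousLinearMap.intervalIntegral_comp_comm (B.flip g)
    (Sd.intervalIntegrable_orbit ψ le_rfl hτ)).symm.trans
    (intervalIntegral.integral_congr fun t ht => ?_)
  rw [uIcc_of_le hτ] at ht
  exact (hd t ht.1 ψ g).symm

variable {X Y : Type*}
  [NormedAddCommGroup X] [NormedSpace ℝ X] [Lattice X]
  [NormedAddCommGroup Y] [NormedSpace ℝ Y] [Lattice Y]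
  {B : Y →L[ℝ] X →L[ℝ] ℝ} {S : C0Semigroup X} {Sd : C0Semigroup Y}
  {NX : Fin 2 → LatticeNorm X} {NY : Fin 2 → LatticeNorm Y} {g : X} {ψ : Y} {ω : ℝ}

lemma exists_le_integral_of_not_finitePotential (hB : OrderDuality B) (hS : S.IsPositive)
    (hg : 0 ≤ g) (hψ : 0 ≤ ψ) (hinf : ¬ FinitePotential B (S.rescale ω) ψ g) (R : ℝ) :
    ∃ τ₀ e, 0 ≤ τ₀ ∧ 0 < e ∧ ∀ κ, ω ≤ κ → κ ≤ ω + e → ∀ τ, τ₀ ≤ τ →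
      R ≤ ∫ t in (0 : ℝ)..τ, B ψ ((S.rescale κ).op t g) := by
  have hcont κ := (S.rescale κ).continuousOn_apply_orbit (B ψ) g
  have hint κ {r t : ℝ} (hr : 0 ≤ r) (hrt : r ≤ t) := ((hcont κ).mono
    fun _ hs => hr.trans hs.1).intervalIntegrable_of_Icc (μ := volume) hrt
  have hnonneg : ∀ t, 0 ≤ t → 0 ≤ B ψ (S.op t g) := fun t ht =>
    hB.pairing_nonneg hψ (hS t ht g hg)
  have hnonneg' : ∀ κ t, 0 ≤ t → 0 ≤ B ψ ((S.rescale κ).op t g) := fun κ t ht => by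
    rw [C0Semigroup.rescale_op_apply, map_smul]
    exact mul_nonneg (Real.exp_pos _).le (hnonneg t ht)
  obtain ⟨τ₀, hτ₀, hlarge⟩ :
      ∃ τ₀, 0 ≤ τ₀ ∧ 2 * R < ∫ t in (0 : ℝ)..τ₀, B ψ ((S.rescale ω).op t g) := by
    by_contra! hcon
    exact hinf (integrableOn_Ioi_of_integral_le (hcont ω) (hnonneg' ω) hcon)
  refine ⟨τ₀, 1 / (2 * (τ₀ + 1)), hτ₀, by positivity, fun κ _ hκ τ hτ => ?_⟩
  have hhalf : ∀ t ∈ Icc 0 τ₀,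
      B ψ ((S.rescale ω).op t g) ≤ 2 * B ψ ((S.rescale κ).op t g) := fun t ht => by
    have hexp : (κ - ω) * t ≤ 1 / 2 := by
      calc (κ - ω) * t ≤ 1 / (2 * (τ₀ + 1)) * (τ₀ + 1) :=
            mul_le_mul (by linarith) (by linarith [ht.2]) ht.1 (by positivity)
        _ = 1 / 2 := by field_simp
    have hκω : S.rescale κ = (S.rescale ω).rescale (κ - ω) := by
      rw [S.rescale_rescale, add_sub_cancel]
    rw [hκω, (S.rescale ω).rescale_op_apply (κ - ω), map_smul, smul_eq_mul, ← mul_assoc]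
    exact le_mul_of_one_le_left (hnonneg' ω t ht.1)
      (by linarith [Real.add_one_le_exp (-((κ - ω) * t))])
  have hhead : ∫ t in (0 : ℝ)..τ₀, B ψ ((S.rescale ω).op t g)
      ≤ 2 * ∫ t in (0 : ℝ)..τ₀, B ψ ((S.rescale κ).op t g) := by
    rw [← intervalIntegral.integral_const_mul]
    exact intervalIntegral.integral_mono_on hτ₀ (hint ω le_rfl hτ₀)
      ((hint κ le_rfl hτ₀).const_mul 2) hhalf
  have htail : 0 ≤ ∫ t in τ₀..τ, B ψ ((S.rescale κ).op t g) :=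
    intervalIntegral.integral_nonneg hτ fun t ht => hnonneg' κ t (hτ₀.trans ht.1)
  linarith [intervalIntegral.integral_add_adjacent_intervals (hint κ le_rfl hτ₀) (hint κ hτ₀ hτ)]

variable [IsOrderedAddMonoid Y] [IsOrderedModule ℝ Y] [HasSolidNorm Y] [CompleteSpace Y]

/-- The approximate eigenvectors are the normalised truncated Laplace transforms of the orbit of
`ψ`: their norm blows up at the abscissa of convergence while the boundary terms stay bounded. -/
lemma exists_approx_eigenvector (hB : OrderDuality B) (hS : S.IsPositive)
    (hd : DualSemigroups B S Sd) (hN : CompatibleNorms B NX NY) (hg : 0 ≤ g) (hψ : 0 ≤ ψ)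
    (hinf : ¬ FinitePotential B (S.rescale ω) ψ g)
    (hstab : ∃ᶠ κ in 𝓝[≥] ω, (Sd.rescale κ).StableOnCone (NY 0)) {e t : ℝ} (he : 0 < e)
    (ht : 0 ≤ t) :
    ∃ (κ : ℝ) (φ : Y), ω ≤ κ ∧ κ ≤ ω + e ∧ 0 ≤ φ ∧ NY 0 φ = 1 ∧
      ∀ s : ℝ, 0 ≤ s → s ≤ t → NY 0 ((Sd.rescale κ).op s φ - φ) ≤ e := by
  obtain ⟨D, hD⟩ := isCompact_Icc.bddAbove_image
    (((NY 0).continuousOn_orbit (Sd.rescale ω) ψ).mono (Icc_subset_Ici_self : Icc 0 t ⊆ Ici 0))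
  have hDω : ∀ r, 0 ≤ r → r ≤ t → NY 0 ((Sd.rescale ω).op r ψ) ≤ D :=
    fun r h0 h1 => hD ⟨r, ⟨h0, h1⟩, rfl⟩
  have hψD : NY 0 ψ ≤ D := by simpa only [C0Semigroup.op_zero_apply] using hDω 0 le_rfl ht
  have hD0 : 0 ≤ D := ((NY 0).nonneg ψ).trans hψD
  have : 0 ≤ NX 1 g := (NX 1).nonneg g
  obtain ⟨τ₀, e', hτ₀, he', hlarge⟩ := exists_le_integral_of_not_finitePotential hB hS hg hψ hinf
    ((2 * (t * D) / e + 1) * (NX 1 g + 1))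
  obtain ⟨κ, hκstab, hωκ : ω ≤ κ, hκe, hκe'⟩ := (hstab.and_eventually
    (eventually_mem_nhdsWithin.and (((eventually_le_nhds (by linarith : ω < ω + e)).and
      (eventually_le_nhds (by linarith : ω < ω + e'))).filter_mono nhdsWithin_le_nhds))).exists
  obtain ⟨t₁, -, hsmall⟩ := hκstab 1 one_pos
  set τ := max τ₀ t₁
  have hτ : 0 ≤ τ := hτ₀.trans (le_max_left _ _)
  set Φ : Y := ∫ r in (0 : ℝ)..τ, (Sd.rescale κ).op r ψ
  have hΦ : 2 * (t * D) / e + 1 ≤ NY 0 Φ := by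
    refine le_of_mul_le_mul_right ?_ (by positivity : 0 < NX 1 g + 1)
    have hΦg := (le_abs_self _).trans (hN.pairing_01 Φ g)
    have hlarge' := hlarge κ hωκ hκe' τ (le_max_left _ _)
    rw [← (hd.rescale κ).pairing_integral ψ g hτ] at hlarge'
    linarith [(NY 0).nonneg Φ]
  have hΦ0 : 0 < NY 0 Φ := lt_of_lt_of_le (by positivity) hΦ
  refine ⟨κ, (NY 0 Φ)⁻¹ • Φ, hωκ, hκe, smul_nonneg (inv_nonneg.2 hΦ0.le)
    (((hd.isPositive hB hS).rescale κ).integral_nonneg hψ hτ), (NY 0).map_inv_smul_self hΦ0,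
    fun s hs hst => ?_⟩
  have hfirst : ∀ r, 0 ≤ r → r ≤ s → NY 0 ((Sd.rescale κ).op r ψ) ≤ D := fun r hr hrs => by
    refine le_trans ?_ (hDω r hr (hrs.trans hst))
    rw [LatticeNorm.rescale_op, LatticeNorm.rescale_op]
    have := (NY 0).nonneg (Sd.op r ψ)
    gcongr
  have hΦs := (NY 0).op_integral_sub_le (Sd.rescale κ) hs hτ hfirst fun r hr =>
    ((hsmall ψ hψ r ((le_max_right _ _).trans hr)).trans_eq (one_mul _)).trans hψD
  rw [map_smul, ← smul_sub, LatticeNorm.map_smul_of_nonneg _ (inv_nonneg.2 hΦ0.le),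
    inv_mul_le_iff₀ hΦ0]
  calc _ ≤ 2 * (s * D) := hΦs
    _ ≤ 2 * (t * D) / e * e := by rw [div_mul_cancel₀ _ he.ne']; gcongr
    _ ≤ NY 0 Φ * e := by gcongr; linarith

end ApproximateEigenvectors

section DualEigenvector

variable {X Y : Type*}
  [NormedAddCommGroup X] [NormedSpace ℝ X]
  [NormedAddCommGroup Y] [NormedSpace ℝ Y] [Lattice Y]
  {B : Y →L[ℝ] X →L[ℝ] ℝ} {S : C0Semigroup X} {Sd : C0Semigroup Y}
  {NY : Fin 2 → LatticeNorm Y} {lam lam₀ lam' b C₀ C₁ C₀' : ℝ}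
  {x Ξ₀ : ℝ} {g : X} {φ ψ : Y}

variable [IsOrderedAddMonoid Y]

lemma half_le_of_tendsto_pairing {u w : ℕ → Y} {M : ℝ} (hu : ∀ n, NY 0 (u n) = 1)
    (hw : ∀ n, 0 ≤ w n) (huw : Tendsto (fun n => NY 0 (u n - w n)) atTop (𝓝 0))
    (hM : ∀ n, NY 1 (w n) ≤ M) (hx : 0 ≤ x) (hxM : x * M ≤ 1 / 2)
    (hint : ∀ φ, NY 0 φ ≤ x * NY 1 φ + Ξ₀ * bracketY B g φ)
    (hlim : Tendsto (fun n => B (w n) g) atTop (𝓝 (B φ g))) : 1 / 2 ≤ Ξ₀ * B φ g := by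
  have hle : ∀ n, 1 ≤ NY 0 (u n - w n) + (1 / 2 + Ξ₀ * B (w n) g) := fun n => by
    have hsplit := map_add_le_add (NY 0).toSeminorm (u n - w n) (w n)
    rw [sub_add_cancel, hu] at hsplit
    have hwint := hint (w n)
    rw [bracketY, abs_of_nonneg (hw n)] at hwint
    linarith [mul_le_mul_of_nonneg_left (hM n) hx]
  linarith [ge_of_tendsto' (huw.add ((hlim.const_mul Ξ₀).const_add (1 / 2))) hle]

variable [IsOrderedModule ℝ Y] [HasSolidNorm Y] [CompleteSpace Y]

lemma DualSplitting.exists_bounded_approx (hsplit : DualSplitting b C₀ C₁ Sd NY)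
    (hSd : Sd.IsPositive) (hb : b < 0) (hC₁ : 0 ≤ C₁) {t e : ℝ} (ht : 0 < t) (hφ : 0 ≤ φ)
    (happ : ∀ s, 0 ≤ s → s ≤ t → NY 0 (Sd.op s φ - φ) ≤ e) :
    ∃ w, 0 ≤ w ∧ NY 0 (φ - w) ≤ e + C₀ * Real.exp (b * t) * NY 0 φ ∧
      NY 1 w ≤ C₁ * ((NY 0 φ + e) / -b) := by
  obtain ⟨w, hw, hw0, hw1⟩ := hsplit.exists_decomposition hSd hφ ht
  have horbit : ∀ s ∈ Icc 0 t, NY 0 (Sd.op s φ) ≤ NY 0 φ + e := fun s hs => by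
    have := map_add_le_add (NY 0).toSeminorm φ (Sd.op s φ - φ)
    rw [add_sub_cancel] at this
    linarith [happ s hs.1 hs.2]
  refine ⟨w, hw, ?_, hw1.trans (mul_le_mul_of_nonneg_left ?_ hC₁)⟩
  · have := map_sub_le_add (NY 0).toSeminorm (Sd.op t φ - w) (Sd.op t φ - φ)
    rw [sub_sub_sub_cancel_left] at this
    linarith [happ t ht.le le_rfl]
  · have hD : 0 ≤ NY 0 φ + e := ((NY 0).nonneg _).trans (horbit t ⟨ht.le, le_rfl⟩)
    exact (expConv_mono le_rfl ht.le ((NY 0).continuousOn_orbit Sd φ) continuousOn_const horbit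
      fun _ _ => hD).trans (expConv_const_le hb hD t)

variable [Lattice X] {NX : Fin 2 → LatticeNorm X}

/-- At the abscissa of convergence of the Laplace transform of `t ↦ ⟨ψ, S_t g⟩` the Laplace
transform diverges, because convergence is an open condition. -/
lemma exists_abscissa {a : ℝ} (hB : OrderDuality B) (hS : S.IsPositive)
    (hd : DualSemigroups B S Sd) (hN : CompatibleNorms B NX NY) (hψ : 0 ≤ ψ)
    (hgrowth : GrowthBound lam' C₀' S (NX 1)) (ha : a < lam₀)
    (hstab : ∀ κ, a ≤ κ → FinitePotential B (S.rescale κ) ψ g →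
      (Sd.rescale κ).StableOnCone (NY 0))
    (hlt : ∀ κ, (Sd.rescale κ).StableOnCone (NY 0) → lam₀ < κ) :
    ∃ ω, lam₀ ≤ ω ∧ ¬ FinitePotential B (S.rescale ω) ψ g ∧
      ∃ᶠ κ in 𝓝[≥] ω, (Sd.rescale κ).StableOnCone (NY 0) := by
  set I : Set ℝ := {κ | a ≤ κ ∧ FinitePotential B (S.rescale κ) ψ g}
  have hI : ∀ κ ∈ I, lam₀ < κ := fun κ hκ => hlt κ (hstab κ hκ.1 hκ.2)
  have hne : I.Nonempty := by
    refine ⟨max a (lam' + 1), le_max_left _ _, finitePotential_rescale_of_le (a := lam')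
      (D := NY 0 ψ * (C₀' * NX 1 g)) (fun t ht => ?_)
      ((lt_add_one lam').trans_le (le_max_right _ _))⟩
    calc |B ψ (S.op t g)| ≤ NY 0 ψ * (C₀' * Real.exp (lam' * t) * NX 1 g) :=
          (hN.pairing_01 _ _).trans
            (mul_le_mul_of_nonneg_left (hgrowth g t ht) ((NY 0).nonneg ψ))
      _ = _ := by ring
  have hglb : IsGLB I (sInf I) := isGLB_csInf hne ⟨lam₀, fun κ hκ => (hI κ hκ).le⟩
  have hω : lam₀ ≤ sInf I := hglb.2 fun κ hκ => (hI κ hκ).le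
  have hopen : sInf I ∉ I := fun hmem => by
    obtain ⟨δ, hδ, hdecay⟩ := (hstab _ hmem.1 hmem.2).exists_exp_decay
      ((hd.isPositive hB hS).rescale _)
    obtain ⟨D, hD⟩ := hdecay ψ hψ
    set δ' := min (δ / 2) (sInf I - a)
    have hδ' : 0 < δ' := lt_min (half_pos hδ) (by linarith)
    have hfin : FinitePotential B ((S.rescale (sInf I)).rescale (-δ')) ψ g := by
      refine finitePotential_rescale_of_le (a := -δ) (D := D * NX 1 g) (fun t ht => ?_)
        (by linarith [min_le_left (δ / 2) (sInf I - a)])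
      rw [hd.rescale _ t ht]
      calc _ ≤ NY 0 ((Sd.rescale (sInf I)).op t ψ) * NX 1 g := hN.pairing_01 _ _
        _ ≤ D * Real.exp (-(δ * t)) * NX 1 g :=
          mul_le_mul_of_nonneg_right (hD t ht) ((NX 1).nonneg g)
        _ = _ := by rw [neg_mul]; ring
    rw [C0Semigroup.rescale_rescale] at hfin
    linarith [hglb.1 ⟨by linarith [min_le_right (δ / 2) (sInf I - a)], hfin⟩]
  refine ⟨sInf I, hω, fun hfin => hopen ⟨ha.le.trans hω, hfin⟩, ?_⟩
  exact (hglb.frequently_mem hne).mono fun κ hκ => hstab κ hκ.1 hκ.2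

lemma exists_approx_eigenvector_seq (hB : OrderDuality B) (hS : S.IsPositive)
    (hd : DualSemigroups B S Sd) (hN : CompatibleNorms B NX NY)
    (hsplit : DualSplitting lam C₀ C₁ Sd NY) (hlam : lam < lam₀) (hC₀ : 0 ≤ C₀) (hC₁ : 0 ≤ C₁)
    (hg : 0 ≤ g) (hψ : 0 ≤ ψ) {ω : ℝ} (hω : lam₀ ≤ ω)
    (hinf : ¬ FinitePotential B (S.rescale ω) ψ g)
    (hstab : ∃ᶠ κ in 𝓝[≥] ω, (Sd.rescale κ).StableOnCone (NY 0)) :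
    ∃ (κ : ℕ → ℝ) (u w : ℕ → Y), Tendsto κ atTop (𝓝 ω) ∧ (∀ n, NY 0 (u n) = 1) ∧
      (∀ t, 0 ≤ t →
        Tendsto (fun n => NY 0 ((Sd.rescale (κ n)).op t (u n) - u n)) atTop (𝓝 0)) ∧
      (∀ n, 0 ≤ w n) ∧ Tendsto (fun n => NY 0 (u n - w n)) atTop (𝓝 0) ∧
      ∀ n, NY 1 (w n) ≤ C₁ * (2 / (lam₀ - lam)) := by
  have hSd := hd.isPositive hB hS
  have he : ∀ n : ℕ, (0 : ℝ) < 1 / (n + 1) := fun n => Nat.one_div_pos_of_nat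
  have helim : Tendsto (fun n : ℕ => (1 : ℝ) / (n + 1)) atTop (𝓝 0) :=
    tendsto_one_div_add_atTop_nhds_zero_nat
  choose κ u hωκ hκω hu hu1 happ using fun n : ℕ => exists_approx_eigenvector (t := n + 1) hB hS
    hd hN hg hψ hinf hstab (he n) (by positivity)
  choose w hw huw hw1 using fun n : ℕ =>
    ((hsplit.rescale (κ n)).mono (b := lam - lam₀) (by linarith [hωκ n]) hC₀
      hC₁).exists_bounded_approx (hSd.rescale (κ n)) (by linarith) hC₁ (by positivity) (hu n)
      (happ n)
  simp only [hu1, mul_one, neg_sub] at huw hw1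
  refine ⟨κ, u, w, ?_, hu1, fun t ht => ?_, hw, ?_, fun n => ?_⟩
  · refine tendsto_of_tendsto_of_tendsto_of_le_of_le tendsto_const_nhds ?_ hωκ hκω
    simpa using helim.const_add ω
  · refine squeeze_zero' (.of_forall fun n => (NY 0).nonneg _) ?_ helim
    filter_upwards [tendsto_natCast_atTop_atTop.eventually_ge_atTop t] with n hn
    exact happ n t ht (by linarith)
  · refine squeeze_zero (fun n => (NY 0).nonneg _) huw ?_
    simpa using helim.add (((tendsto_exp_mul_zero (sub_neg.2 hlam)).comp
      (tendsto_atTop_add_const_right _ 1 tendsto_natCast_atTop_atTop)).const_mul C₀)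
  · refine (hw1 n).trans (mul_le_mul_of_nonneg_left ?_ hC₁)
    have : (1 : ℝ) / (n + 1) ≤ 1 := (Nat.one_div_le_one_div n.zero_le).trans_eq (by simp)
    gcongr
    linarith

theorem exists_dual_eigenvector [IsOrderedAddMonoid X] [IsOrderedModule ℝ X] [HasSolidNorm X]
    [CompleteSpace X] (hB : OrderDuality B) (hS : S.IsPositive)
    (hd : DualSemigroups B S Sd) (hN : CompatibleNorms B NX NY)
    (hdiss : StronglyDissipative lam C₀ C₁ S NX) (hsplit : DualSplitting lam C₀ C₁ Sd NY)
    (hsuper : HasSupereigenvector lam₀ S ∨ HasSupereigenvector lam₀ Sd)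
    (hgrowth : GrowthBound lam' C₀' S (NX 1)) (hcompact : WeaklySeqCompactBalls B (NY 1))
    (hlam : lam < lam₀) (hC₀ : 0 ≤ C₀) (hC₁ : 0 ≤ C₁)
    (hg : 0 ≤ g) (hψ : 0 ≤ ψ) (hx : 0 ≤ x) (hΞ₀ : 0 ≤ Ξ₀)
    (hintX : ∀ f, NX 0 f ≤ x * NX 1 f + Ξ₀ * bracketX B ψ f)
    (hintY : ∀ φ, NY 0 φ ≤ x * NY 1 φ + Ξ₀ * bracketY B g φ)
    (hxC₁ : C₁ * x ≤ (lam₀ - lam) / 4) :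
    ∃ (ω : ℝ) (φ : Y), lam₀ ≤ ω ∧ 0 ≤ φ ∧ NY 0 φ = 1 ∧ (Sd.rescale ω).IsStationary φ := by
  have hSd := hd.isPositive hB hS
  obtain ⟨ω, hω, hinf, hstab⟩ := exists_abscissa (lam₀ := lam₀) (a := (lam + lam₀) / 2) hB hS hd
    hN hψ hgrowth (by linarith)
    (fun κ hκ hfin => hfin.stableOnCone hB (hS.rescale κ) (hd.rescale κ) hN (hdiss.rescale κ)
      (hsplit.rescale κ) hC₁ hg hψ hx hΞ₀ hintX hintY (by linarith))
    (fun κ hκ => hsuper.elim (hκ.lt_of_hasSupereigenvector_dual hB hS hd hN)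
      (hκ.lt_of_hasSupereigenvector hSd))
  obtain ⟨κ, u, w, hκ, hu, happ, hw, huw, hM⟩ := exists_approx_eigenvector_seq hB hS hd hN hsplit
    hlam hC₀ hC₁ hg hψ hω hinf hstab
  obtain ⟨φ, σ, hσ, hφw⟩ := hcompact w _ hM
  replace hσ := hσ.tendsto_atTop
  have hφu : ∀ f, Tendsto (fun n => B (u (σ n)) f) atTop (𝓝 (B φ f)) := fun f => by
    simpa using (hN.tendsto_pairing_zero (huw.comp hσ) f).add (hφw f)
  have hφ0 : 0 ≤ φ := (hB.nonneg_left φ).2 fun f hf =>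
    ge_of_tendsto' (hφw f) fun n => hB.pairing_nonneg (hw _) hf
  have hstat : (Sd.rescale ω).IsStationary φ :=
    isStationary_rescale_of_tendsto_pairing hB hd hN (hκ.comp hσ) hφu fun t ht =>
      (happ t ht).comp hσ
  have hxM : x * (C₁ * (2 / (lam₀ - lam))) ≤ 1 / 2 := by
    calc x * (C₁ * (2 / (lam₀ - lam))) = C₁ * x * 2 / (lam₀ - lam) := by ring
      _ ≤ 1 / 2 := by rw [div_le_iff₀ (by linarith)]; linarith
  have hφg : 1 / 2 ≤ Ξ₀ * B φ g := half_le_of_tendsto_pairing (fun n => hu (σ n))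
    (fun n => hw (σ n)) (huw.comp hσ) (fun n => hM (σ n)) hx hxM hintY (hφw g)
  have hφ_pos : 0 < NY 0 φ := by
    refine (NY 0).pos ?_
    rintro rfl
    norm_num at hφg
  exact ⟨ω, (NY 0 φ)⁻¹ • φ, hω, smul_nonneg (inv_nonneg.2 hφ_pos.le) hφ0,
    (NY 0).map_inv_smul_self hφ_pos, hstat.smul _⟩

end DualEigenvector

/-! ### Invariant functionals -/

lemma abs_sub_le_add_sub_add {E : Type*} [AddCommGroup E] [Lattice E] [IsOrderedAddMonoid E]
    {p q c : E} (hp : c ≤ p) (hq : c ≤ q) : |p - q| ≤ p + q - (c + c) := by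
  refine abs_le'.2 ⟨sub_nonneg.1 ?_, sub_nonneg.1 ?_⟩
  · rw [show p + q - (c + c) - (p - q) = (q - c) + (q - c) by abel]
    exact add_nonneg (sub_nonneg.2 hq) (sub_nonneg.2 hq)
  · rw [show p + q - (c + c) - -(p - q) = (p - c) + (p - c) by abel]
    exact add_nonneg (sub_nonneg.2 hp) (sub_nonneg.2 hp)

section InvariantFunctional

variable {X : Type*} [NormedAddCommGroup X] [NormedSpace ℝ X] [Lattice X]
  {S : C0Semigroup X} {ℓ : X →L[ℝ] ℝ}

/-- `ℓ` is a positive linear functional that is invariant under the semigroup `S`. In Harris'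
theorem it plays the role of the total mass, and `f ↦ ℓ |f|` that of the total variation. -/
structure C0Semigroup.IsInvariantFunctional (S : C0Semigroup X) (ℓ : X →L[ℝ] ℝ) : Prop where
  nonneg : ∀ f, 0 ≤ f → 0 ≤ ℓ f
  invariant : ∀ t, 0 ≤ t → ∀ f, ℓ (S.op t f) = ℓ f

namespace C0Semigroup.IsInvariantFunctional

/-- Otherwise the whole mass of `f` would be bounded by the small multiple `x ‖S_t f‖₁` of
itself. -/
lemma apply_le_of_interpolation (hℓ : S.IsInvariantFunctional ℓ) {N₀ N₁ : LatticeNorm X}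
    {f : X} {t K x D r : ℝ} (ht : 0 ≤ t) (hf : 0 ≤ f) (hK : 0 ≤ K) (hx : 0 ≤ x)
    (hle : ∀ f, ℓ f ≤ K * N₀ f) (hint : N₀ (S.op t f) ≤ x * N₁ (S.op t f) + r)
    (hD : N₁ (S.op t f) ≤ D * ℓ f) (hKxD : K * (x * D) ≤ 1 / 2) : ℓ f ≤ 2 * (K * r) := by
  have hmass := hℓ.nonneg f hf
  have : ℓ f ≤ K * (x * (D * ℓ f) + r) := by
    calc ℓ f = ℓ (S.op t f) := (hℓ.invariant t ht f).symm
      _ ≤ K * N₀ (S.op t f) := hle _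
      _ ≤ K * (x * (D * ℓ f) + r) := by gcongr; exact hint.trans (by gcongr)
  nlinarith

variable [IsOrderedAddMonoid X]

lemma mono (hℓ : S.IsInvariantFunctional ℓ) {f h : X} (hfh : f ≤ h) : ℓ f ≤ ℓ h := by
  simpa only [map_sub, sub_nonneg] using hℓ.nonneg _ (sub_nonneg.2 hfh)

lemma antitoneOn_abs_orbit (hℓ : S.IsInvariantFunctional ℓ) (hS : S.IsPositive) (f : X) :
    AntitoneOn (fun t => ℓ |S.op t f|) (Ici 0) := fun s hs t _ hst => by
  have hts := sub_nonneg.2 hst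
  calc ℓ |S.op t f| = ℓ |S.op (t - s) (S.op s f)| := by
        rw [← S.op_add_apply hts hs, sub_add_cancel]
    _ ≤ ℓ (S.op (t - s) |S.op s f|) := hℓ.mono (hS.abs_le hts _)
    _ = ℓ |S.op s f| := hℓ.invariant _ hts _

/-- Doblin's argument: the mass common to `S_T f⁺` and `S_T f⁻` cancels in `S_T f`. -/
lemma apply_abs_op_le_of_minorization (hℓ : S.IsInvariantFunctional ℓ) {f g : X} {T e θ : ℝ}
    (hT : 0 ≤ T) (he : 0 ≤ e) (hf : ℓ f = 0) (hpos : (e * ℓ f⁺) • g ≤ S.op T f⁺)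
    (hneg : (e * ℓ f⁻) • g ≤ S.op T f⁻) (hg : θ ≤ ℓ g) :
    ℓ |S.op T f| ≤ (1 - e * θ) * ℓ |f| := by
  have hsub : ℓ f⁺ - ℓ f⁻ = 0 := by rw [← map_sub, posPart_sub_negPart, hf]
  have hadd : ℓ f⁺ + ℓ f⁻ = ℓ |f| := by rw [← map_add, posPart_add_negPart]
  rw [← sub_eq_zero.1 hsub] at hneg
  set c := (e * ℓ f⁺) • g with hc
  have habs : |S.op T f| ≤ S.op T |f| - (c + c) := by
    rw [← posPart_add_negPart f, map_add]
    nth_rewrite 1 [← posPart_sub_negPart f]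
    rw [map_sub]
    exact abs_sub_le_add_sub_add hpos hneg
  have hmass : 0 ≤ ℓ |f| := hℓ.nonneg _ (abs_nonneg f)
  calc ℓ |S.op T f| ≤ ℓ |f| - (ℓ c + ℓ c) := by
        simpa only [map_sub, map_add, hℓ.invariant T hT] using hℓ.mono habs
    _ = (1 - e * ℓ g) * ℓ |f| := by
        rw [hc, map_smul, smul_eq_mul, ← hadd, ← sub_eq_zero.1 hsub]; ring
    _ ≤ (1 - e * θ) * ℓ |f| := by gcongr

end C0Semigroup.IsInvariantFunctional

variable {NX : Fin 2 → LatticeNorm X} {b C₀ C₁ x M a : ℝ} [IsOrderedAddMonoid X]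
  [IsOrderedModule ℝ X] [HasSolidNorm X] [CompleteSpace X]

lemma StronglyDissipative.lyapunov (hdiss : StronglyDissipative b C₀ C₁ S NX)
    (hℓ : S.IsInvariantFunctional ℓ) (hS : S.IsPositive) (hC₀ : 0 ≤ C₀) (hC₁ : 0 ≤ C₁)
    (hx : 0 ≤ x) (hM : 0 ≤ M) (hint : ∀ f, NX 0 f ≤ x * NX 1 f + M * ℓ |f|) (ha : 0 < a)
    (hba : b + C₁ * x ≤ -a) {t : ℝ} (ht : 0 ≤ t) (f : X) :
    NX 1 (S.op t f) ≤ (C₀ + 1) * Real.exp (-(a * t)) * NX 1 f + C₁ * M / a * ℓ |f| := by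
  have hN := (NX 1).nonneg f
  have hmass := hℓ.nonneg _ (abs_nonneg f)
  rcases ht.eq_or_lt with rfl | ht
  · rw [S.op_zero_apply, mul_zero, neg_zero, Real.exp_zero]
    have : 0 ≤ C₁ * M / a * ℓ |f| := by positivity
    nlinarith
  set β := b + C₁ * x
  have horbit : NX 1 (S.op t f) ≤ C₀ * NX 1 f * Real.exp (β * t)
      + expConv β (fun _ => C₁ * (M * ℓ |f|)) t := by
    refine hdiss.orbit_le hC₁ hx continuousOn_const (fun s hs => (hint _).trans ?_) ht
    have : ℓ |S.op s f| ≤ ℓ |f| := by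
      simpa only [S.op_zero_apply] using hℓ.antitoneOn_abs_orbit hS f self_mem_Ici hs hs
    gcongr
  have hconv : expConv β (fun _ => C₁ * (M * ℓ |f|)) t ≤ C₁ * (M * ℓ |f|) / -β :=
    expConv_const_le (by linarith) (by positivity) t
  calc NX 1 (S.op t f) ≤ C₀ * NX 1 f * Real.exp (β * t) + C₁ * (M * ℓ |f|) / -β :=
        horbit.trans (by gcongr)
    _ ≤ (C₀ + 1) * NX 1 f * Real.exp (-a * t) + C₁ * (M * ℓ |f|) / a := by
        gcongr <;> linarith
    _ = _ := by ring_nf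

end InvariantFunctional

section StationaryVector

namespace LatticeNorm

variable {E : Type*} [AddCommGroup E] [Module ℝ E] [Lattice E] {N : LatticeNorm E} {u : ℕ → E}

lemma nonneg_of_tendsto [IsOrderedAddMonoid E] {y : E} (hu : ∀ n, 0 ≤ u n)
    (h : Tendsto (fun n => N (u n - y)) atTop (𝓝 0)) : 0 ≤ y := by
  have hle : ∀ n, N y⁻ ≤ N (u n - y) := fun n => by
    refine N.solid _ _ ?_
    rw [abs_of_nonneg (negPart_nonneg y)]
    refine sup_le (le_trans ?_ (le_abs_self _)) (abs_nonneg _)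
    rw [sub_eq_add_neg]
    exact le_add_of_nonneg_left (hu n)
  exact negPart_eq_zero.1 (N.eq_zero_of _ (le_antisymm (ge_of_tendsto' h hle) (N.nonneg _)))

lemma IsBanach.exists_tendsto (hN : N.IsBanach) {r : ℕ → ℝ} (hr : Tendsto r atTop (𝓝 0))
    (h : ∀ m n, m ≤ n → N (u n - u m) ≤ r m) :
    ∃ x, Tendsto (fun n => N (u n - x)) atTop (𝓝 0) := by
  refine hN u fun e he => ?_
  obtain ⟨n₀, hn₀⟩ := eventually_atTop.1 (hr.eventually_lt_const he)
  refine ⟨n₀, fun m n hm hn => ?_⟩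
  rcases le_total m n with hmn | hnm
  · rw [map_sub_rev]
    exact (h m n hmn).trans_lt (hn₀ m hm)
  · exact (h n m hnm).trans_lt (hn₀ n hn)

end LatticeNorm

variable {X : Type*} [NormedAddCommGroup X] [NormedSpace ℝ X] [Lattice X] [IsOrderedAddMonoid X]
  {S : C0Semigroup X} {ℓ : X →L[ℝ] ℝ}

lemma C0Semigroup.IsInvariantFunctional.exists_isStationary (hℓ : S.IsInvariantFunctional ℓ)
    (hS : S.IsPositive) {N : LatticeNorm X} (hN : N.IsBanach) (hle : ∀ f, |ℓ f| ≤ N f)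
    {M C δ : ℝ} (hM : ∀ t, 0 ≤ t → ∀ f, N (S.op t f) ≤ M * N f) (hC : 0 ≤ C) (hδ : 0 < δ)
    (hdecay : ∀ f, ℓ f = 0 → ∀ t, 0 ≤ t → N (S.op t f) ≤ C * Real.exp (-(δ * t)) * N f)
    {h : X} (hh : 0 ≤ h) (hℓh : ℓ h = 1) : ∃ f₁, 0 ≤ f₁ ∧ ℓ f₁ = 1 ∧ S.IsStationary f₁ := by
  set r : ℝ → ℝ := fun t => C * Real.exp (-δ * t) * (M * N h + N h)
  have hcauchy : ∀ s t, 0 ≤ s → 0 ≤ t → N (S.op (t + s) h - S.op t h) ≤ r t := by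
    intro s t hs ht
    have hker : ℓ (S.op s h - h) = 0 := by rw [map_sub, hℓ.invariant s hs, sub_self]
    rw [S.op_add_apply ht hs, ← map_sub]
    refine (hdecay _ hker t ht).trans ?_
    rw [← neg_mul]
    have : N (S.op s h - h) ≤ M * N h + N h :=
      (map_sub_le_add _ _ _).trans (add_le_add_left (hM s hs h) _)
    exact mul_le_mul_of_nonneg_left this (by positivity)
  have hr : Tendsto (fun n : ℕ => r n) atTop (𝓝 0) := by
    simpa [r] using (((tendsto_exp_mul_zero (neg_lt_zero.2 hδ)).comp
      tendsto_natCast_atTop_atTop).const_mul C).mul_const (M * N h + N h)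
  obtain ⟨f₁, hf₁⟩ := hN.exists_tendsto (u := fun n : ℕ => S.op n h) hr fun m n hmn => by
    simpa using hcauchy (n - m) m (sub_nonneg.2 (Nat.cast_le.2 hmn)) m.cast_nonneg
  refine ⟨f₁, N.nonneg_of_tendsto (fun n => hS n n.cast_nonneg h hh) hf₁, ?_, fun t ht => ?_⟩
  · have hlim : |1 - ℓ f₁| ≤ 0 := ge_of_tendsto' hf₁ fun n => by
      simpa only [map_sub, hℓ.invariant n n.cast_nonneg, hℓh] using hle (S.op n h - f₁)
    linarith [abs_nonpos_iff.1 hlim]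
  · have hsplit : ∀ n : ℕ, N (S.op t f₁ - f₁)
        ≤ r n + N (S.op n h - f₁) + M * N (S.op n h - f₁) := fun n => by
      have heq : S.op t f₁ - f₁ = S.op (n + t) h - S.op n h + (S.op n h - f₁)
          - S.op t (S.op n h - f₁) := by
        rw [map_sub, ← S.op_add_apply ht n.cast_nonneg, add_comm t]
        abel
      rw [heq]
      refine (map_sub_le_add _ _ _).trans (add_le_add ?_ (hM t ht _))
      exact (map_add_le_add _ _ _).trans (add_le_add_left (hcauchy t n ht n.cast_nonneg) _)
    have hlim : N (S.op t f₁ - f₁) ≤ 0 :=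
      ge_of_tendsto' (by simpa using (hr.add hf₁).add (hf₁.const_mul M)) hsplit
    exact sub_eq_zero.1 (N.eq_zero_of _ (hlim.antisymm (N.nonneg _)))

end StationaryVector

section Uniqueness

variable {X Y : Type*}
  [NormedAddCommGroup X] [NormedSpace ℝ X] [Lattice X]
  [NormedAddCommGroup Y] [NormedSpace ℝ Y] [Lattice Y]
  {B : Y →L[ℝ] X →L[ℝ] ℝ} {S : C0Semigroup X} {Sd : C0Semigroup Y}
  {NX : Fin 2 → LatticeNorm X} {NY : Fin 2 → LatticeNorm Y} {N : LatticeNorm Y}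
  {f f₁ : X} {φ φ' : Y} {μ : ℝ}

lemma C0Semigroup.IsStationary.isInvariantFunctional (hφ : Sd.IsStationary φ)
    (hd : DualSemigroups B S Sd) (hB : OrderDuality B) (hφ0 : 0 ≤ φ) :
    S.IsInvariantFunctional (B φ) where
  nonneg _ := hB.pairing_nonneg hφ0
  invariant t ht f := by rw [hd t ht, hφ t ht]

lemma isEigentriplet_iff : IsEigentriplet B S Sd N μ f φ ↔
    (S.rescale μ).IsStationary f ∧ 0 ≤ f ∧ (Sd.rescale μ).IsStationary φ ∧ 0 ≤ φ ∧ N φ = 1 ∧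
      B φ f = 1 := by
  simp only [C0Semigroup.isStationary_rescale_iff]
  exact ⟨fun h => ⟨h.primal, h.primal_nonneg, h.dual, h.dual_nonneg, h.norm_dual, h.pairing⟩,
    fun ⟨h₁, h₂, h₃, h₄, h₅, h₆⟩ => ⟨h₁, h₂, h₃, h₄, h₅, h₆⟩⟩

lemma isEigentriplet_rescale_iff {κ : ℝ} :
    IsEigentriplet B (S.rescale κ) (Sd.rescale κ) N μ f φ ↔
      IsEigentriplet B S Sd N (κ + μ) f φ := by
  simp only [isEigentriplet_iff, C0Semigroup.rescale_rescale]

lemma eq_of_tendsto_zero_on_ker [IsOrderedAddMonoid Y] (hB : OrderDuality B)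
    (hd : DualSemigroups B S Sd) (hN : CompatibleNorms B NX NY) (hφ1 : NY 0 φ = 1)
    (hdecay : ∀ k, B φ k = 0 → Tendsto (fun t => NX 1 (S.op t k)) atTop (𝓝 0))
    (hf₁ : 0 ≤ f₁) (hφf₁ : B φ f₁ = 1) (hφ' : Sd.IsStationary φ') (hφ'0 : 0 ≤ φ')
    (hφ'1 : NY 0 φ' = 1) : φ' = φ := by
  have hker : ∀ k, B φ k = 0 → B φ' k = 0 := fun k hk => by
    refine abs_nonpos_iff.1 (ge_of_tendsto (hdecay k hk) ?_)
    filter_upwards [eventually_ge_atTop 0] with t ht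
    simpa only [hφ'1, one_mul, hd t ht, hφ' t ht] using hN.pairing_01 φ' (S.op t k)
  have hprop : φ' = B φ' f₁ • φ := hB.ext_left fun k => by
    have := hker (k - B φ k • f₁) (by rw [map_sub, map_smul, smul_eq_mul, hφf₁]; ring)
    rw [map_sub, map_smul, smul_eq_mul, sub_eq_zero] at this
    rw [this, map_smul, _root_.smul_apply, smul_eq_mul, mul_comm]
  have hone : B φ' f₁ = 1 := by
    rw [hprop, LatticeNorm.map_smul_of_nonneg _ (hB.pairing_nonneg hφ'0 hf₁), hφ1, mul_one]
      at hφ'1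
    exact hφ'1
  rw [hprop, hone, one_smul]

lemma IsEigentriplet.unique [IsOrderedAddMonoid Y] (hB : OrderDuality B)
    (hd : DualSemigroups B S Sd) (hN : CompatibleNorms B NX NY)
    (hfaithful : ∀ f, 0 ≤ f → B φ f = 0 → f = 0)
    (hdecay : ∀ k, B φ k = 0 → Tendsto (fun t => NX 1 (S.op t k)) atTop (𝓝 0))
    (h₁ : IsEigentriplet B S Sd (NY 0) 0 f₁ φ) (h : IsEigentriplet B S Sd (NY 0) μ f φ') :
    μ = 0 ∧ f = f₁ ∧ φ' = φ := by
  obtain ⟨hstat₁, hf₁, hφ, hφ0, hφ1, hφf₁⟩ := isEigentriplet_iff.1 h₁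
  obtain ⟨hstat, hf, hφ', hφ'0, hφ'1, hφf⟩ := isEigentriplet_iff.1 h
  rw [C0Semigroup.rescale_zero] at hstat₁ hφ
  have hμ : μ = 0 := by
    have hne : B φ f ≠ 0 := fun h0 => by simp [hfaithful f hf h0] at hφf
    have hexp : Real.exp (-(μ * 1)) * B φ f = 1 * B φ f := by
      nth_rewrite 2 [← hstat 1 zero_le_one]
      rw [C0Semigroup.rescale_op_apply, map_smul, smul_eq_mul, hd 1 zero_le_one,
        hφ 1 zero_le_one, one_mul]
    simpa using mul_right_cancel₀ hne hexp
  subst hμ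
  rw [C0Semigroup.rescale_zero] at hstat hφ'
  have hφφ := eq_of_tendsto_zero_on_ker hB hd hN hφ1 hdecay hf₁ hφf₁ hφ' hφ'0 hφ'1
  refine ⟨rfl, sub_eq_zero.1 ((NX 1).eq_zero_of _ ?_), hφφ⟩
  have hlim := hdecay (f - f₁) (by rw [map_sub, ← hφφ, hφf, hφφ, hφf₁, sub_self])
  refine tendsto_nhds_unique (tendsto_const_nhds.congr' ?_) hlim
  filter_upwards [eventually_ge_atTop 0] with t ht
  rw [(S.op t).map_sub, hstat t ht, hstat₁ t ht]

end Uniqueness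

/-! ### Spectral gap at a stationary dual vector -/

section Stationary

variable {X Y : Type*}
  [NormedAddCommGroup X] [NormedSpace ℝ X]
  [NormedAddCommGroup Y] [NormedSpace ℝ Y] [Lattice Y]
  {B : Y →L[ℝ] X →L[ℝ] ℝ} {S : C0Semigroup X} {Sd : C0Semigroup Y}
  {NY : Fin 2 → LatticeNorm Y} {b c C₀ C₁ C₀' : ℝ} {φ : Y}

lemma DualSplitting.exists_approx_seq_of_isStationary [IsOrderedAddMonoid Y]
    [IsOrderedModule ℝ Y] [HasSolidNorm Y] [CompleteSpace Y]
    (hsplit : DualSplitting b C₀ C₁ Sd NY) (hSd : Sd.IsPositive) (hb : b < 0) (hC₁ : 0 ≤ C₁)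
    (hφ : Sd.IsStationary φ) (hφ0 : 0 ≤ φ) (hφ1 : NY 0 φ = 1) :
    ∃ w : ℕ → Y, (∀ n, 0 ≤ w n) ∧ Tendsto (fun n => NY 0 (φ - w n)) atTop (𝓝 0) ∧
      ∀ n, NY 1 (w n) ≤ C₁ / -b := by
  choose w hw hw0 hw1 using fun n : ℕ => hsplit.exists_bounded_approx (t := n + 1) (e := 0) hSd hb
    hC₁ (by positivity) hφ0 fun s hs _ => by rw [hφ s hs, sub_self, map_zero]
  refine ⟨w, hw, squeeze_zero (fun n => (NY 0).nonneg _) hw0 ?_, fun n => (hw1 n).trans_eq ?_⟩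
  · simpa [hφ1] using ((tendsto_exp_mul_zero hb).comp
      (tendsto_atTop_add_const_right _ 1 tendsto_natCast_atTop_atTop)).const_mul C₀
  · rw [hφ1, add_zero, mul_one_div]

lemma GrowthBound.nonneg_of_isStationary [Lattice X] {NX : Fin 2 → LatticeNorm X}
    [IsOrderedAddMonoid Y] (hgrowth : GrowthBound c C₀' S (NX 1)) (hB : OrderDuality B)
    (hd : DualSemigroups B S Sd) (hN : CompatibleNorms B NX NY) (hφ : Sd.IsStationary φ)
    (hφ_ne : φ ≠ 0) : 0 ≤ c := by
  by_contra! hc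
  refine hφ_ne (hB.ext_left fun f => ?_)
  have hle : ∀ t, 0 ≤ t → |B φ f| ≤ NY 0 φ * (C₀' * Real.exp (c * t) * NX 1 f) := fun t ht => by
    have hpairing := hN.pairing_01 φ (S.op t f)
    rw [hd t ht, hφ t ht] at hpairing
    exact hpairing.trans (mul_le_mul_of_nonneg_left (hgrowth f t ht) ((NY 0).nonneg φ))
  have hlim := (((tendsto_exp_mul_zero hc).const_mul C₀').mul_const (NX 1 f)).const_mul (NY 0 φ)
  simp only [mul_zero, zero_mul] at hlim
  rw [map_zero, _root_.zero_apply]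
  exact abs_nonpos_iff.1 (ge_of_tendsto hlim ((eventually_ge_atTop 0).mono hle))

end Stationary

section DoblinHarris

lemma C0Semigroup.smul_le_rescale_op {E : Type*} [NormedAddCommGroup E] [NormedSpace ℝ E]
    [Lattice E] [IsOrderedAddMonoid E] [IsOrderedModule ℝ E] {S : C0Semigroup E}
    {e r ω lam' T₀ T : ℝ} {f h : E} (he : 0 ≤ e) (hr : 0 ≤ r) (hh : 0 ≤ h) (hω : ω ≤ lam')
    (hT : T₀ ≤ T) (hle : (e * r) • h ≤ S.op T f) :
    (e * Real.exp (-(lam' * (T - T₀))) * (Real.exp (-(ω * T₀)) * r)) • h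
      ≤ (S.rescale ω).op T f := by
  rw [rescale_op_apply]
  refine le_trans ?_ (smul_le_smul_of_nonneg_left hle (Real.exp_pos _).le)
  rw [smul_smul]
  refine smul_le_smul_of_nonneg_right ?_ hh
  have hexp : Real.exp (-(lam' * (T - T₀))) * Real.exp (-(ω * T₀)) ≤ Real.exp (-(ω * T)) := by
    rw [← Real.exp_add, Real.exp_le_exp]
    nlinarith
  calc _ = Real.exp (-(lam' * (T - T₀))) * Real.exp (-(ω * T₀)) * (e * r) := by ring
    _ ≤ Real.exp (-(ω * T)) * (e * r) := by gcongr

variable {X Y : Type*}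
  [NormedAddCommGroup X] [NormedSpace ℝ X] [Lattice X] [IsOrderedAddMonoid X]
  [IsOrderedModule ℝ X]
  [NormedAddCommGroup Y] [NormedSpace ℝ Y] [Lattice Y] [IsOrderedAddMonoid Y]
  [IsOrderedModule ℝ Y]
  {B : Y →L[ℝ] X →L[ℝ] ℝ} {S : C0Semigroup X} {Sd : C0Semigroup Y}

lemma DoblinHarris.rescale {T₀ T₁ ω lam' : ℝ} {η : ℝ → ℝ → ℝ} {g : ℝ → X} {ψ : ℝ → Y}
    (h : DoblinHarris T₀ T₁ η B S Sd g ψ) (hB : OrderDuality B) (hS : S.IsPositive)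
    (hSd : Sd.IsPositive) (hT₀ : 0 ≤ T₀) (hT₁ : T₀ ≤ T₁)
    (hη : ∀ ε T, 0 < ε → T₁ ≤ T → 0 ≤ η ε T) (hg : ∀ ε, 0 < ε → 0 ≤ g ε)
    (hψ : ∀ ε, 0 < ε → 0 ≤ ψ ε) (hω : ω ≤ lam') :
    DoblinHarris T₀ T₁ (fun ε T => η ε T * Real.exp (-(lam' * (T - T₀)))) B
      (S.rescale ω) (Sd.rescale ω) g ψ where
  primal ε T hε hT f hf := by
    have hpos := hS T₀ hT₀ f hf
    have hprimal := h.primal ε T hε hT f hf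
    rw [bracketX, abs_of_nonneg hpos] at hprimal
    rw [bracketX, abs_of_nonneg (hS.rescale ω T₀ hT₀ f hf), C0Semigroup.rescale_op_apply,
      map_smul, smul_eq_mul]
    exact C0Semigroup.smul_le_rescale_op (hη ε T hε hT) (hB.pairing_nonneg (hψ ε hε) hpos)
      (hg ε hε) hω (hT₁.trans hT) hprimal
  dual ε T hε hT φ hφ := by
    have hpos := hSd T₀ hT₀ φ hφ
    have hdual := h.dual ε T hε hT φ hφ
    rw [bracketY, abs_of_nonneg hpos] at hdual
    rw [bracketY, abs_of_nonneg (hSd.rescale ω T₀ hT₀ φ hφ), C0Semigroup.rescale_op_apply,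
      map_smul, _root_.smul_apply, smul_eq_mul]
    exact C0Semigroup.smul_le_rescale_op (hη ε T hε hT) (hB.pairing_nonneg hpos (hg ε hε))
      (hψ ε hε) hω (hT₁.trans hT) hdual

end DoblinHarris

section HarrisSystem

variable {X Y : Type*}
  [NormedAddCommGroup X] [NormedSpace ℝ X] [Lattice X]
  [NormedAddCommGroup Y] [NormedSpace ℝ Y] [Lattice Y]
  {B : Y →L[ℝ] X →L[ℝ] ℝ} {S : C0Semigroup X} {Sd : C0Semigroup Y}
  {NX : Fin 2 → LatticeNorm X} {NY : Fin 2 → LatticeNorm Y} {g : ℝ → X} {ψ : ℝ → Y} {φ : Y}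
  {b C₀ C₁ T₀ T₁ ε ε' T t : ℝ} {η : ℝ → ℝ → ℝ} {ξ Ξ : ℝ → ℝ} {f : X}

/-- The coefficient of the mass `⟨φ, |f|⟩` in the Lyapunov estimate of a Harris system. -/
noncomputable def lyapunovConst (b C₁ T₁ : ℝ) (η : ℝ → ℝ → ℝ) (Ξ : ℝ → ℝ) (ε : ℝ) : ℝ :=
  C₁ * (Ξ ε * (2 * Ξ ε / η ε T₁)) / (-b / 2)

/-- `ε` is so small that the interpolation inequality of index `ε` is effective on dual vectors
of `‖·‖₁`-norm at most `C₁ / -b`; `T` is the time at which the constant `η ε T` is used. -/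
structure IsAdmissible (b C₁ : ℝ) (η : ℝ → ℝ → ℝ) (ξ Ξ : ℝ → ℝ) (ε T : ℝ) : Prop where
  mem : ε ∈ Ioc (0 : ℝ) 1
  η_pos : 0 < η ε T
  ξ_nonneg : 0 ≤ ξ ε
  Ξ_pos : 0 < Ξ ε
  mul_le_half : ξ ε * (C₁ / -b) ≤ 1 / 2

lemma IsAdmissible.lyapunovConst_nonneg (hε : IsAdmissible b C₁ η ξ Ξ ε T₁) (hb : b < 0)
    (hC₁ : 0 ≤ C₁) : 0 ≤ lyapunovConst b C₁ T₁ η Ξ ε := by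
  have hη := hε.η_pos
  have hΞ := hε.Ξ_pos
  exact div_nonneg (by positivity) (by linarith)

/-- The hypotheses of the Krein–Rutman–Doblin–Harris theorem together with a normalised dual
eigenvector `φ`, once the semigroups are rescaled so that the eigenvalue of `φ` is `0`. -/
structure IsHarrisSystem (b C₀ C₁ T₀ T₁ : ℝ) (η : ℝ → ℝ → ℝ) (ξ Ξ : ℝ → ℝ)
    (B : Y →L[ℝ] X →L[ℝ] ℝ) (S : C0Semigroup X) (Sd : C0Semigroup Y)
    (NX : Fin 2 → LatticeNorm X) (NY : Fin 2 → LatticeNorm Y) (g : ℝ → X) (ψ : ℝ → Y)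
    (φ : Y) : Prop where
  b_neg : b < 0
  C₀_nonneg : 0 ≤ C₀
  C₁_pos : 0 < C₁
  T₀_nonneg : 0 ≤ T₀
  T₀_le : T₀ ≤ T₁
  duality : OrderDuality B
  positive : S.IsPositive
  dual : DualSemigroups B S Sd
  norms : CompatibleNorms B NX NY
  dissipative : StronglyDissipative b C₀ C₁ S NX
  splitting : DualSplitting b C₀ C₁ Sd NY
  doblinHarris : DoblinHarris T₀ T₁ η B S Sd g ψ
  interpolation : Interpolation ξ Ξ B NX NY g ψ
  g_nonneg : ∀ ε, 0 < ε → 0 ≤ g ε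
  ψ_nonneg : ∀ ε, 0 < ε → 0 ≤ ψ ε
  stationary : Sd.IsStationary φ
  nonneg : 0 ≤ φ
  norm_eq_one : NY 0 φ = 1

namespace IsHarrisSystem

lemma isInvariantFunctional (h : IsHarrisSystem b C₀ C₁ T₀ T₁ η ξ Ξ B S Sd NX NY g ψ φ) :
    S.IsInvariantFunctional (B φ) :=
  h.stationary.isInvariantFunctional h.dual h.duality h.nonneg

variable [IsOrderedAddMonoid Y] [IsOrderedModule ℝ Y] [HasSolidNorm Y] [CompleteSpace Y]

lemma exists_approx_seq (h : IsHarrisSystem b C₀ C₁ T₀ T₁ η ξ Ξ B S Sd NX NY g ψ φ) :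
    ∃ w : ℕ → Y, (∀ n, 0 ≤ w n) ∧ Tendsto (fun n => NY 0 (φ - w n)) atTop (𝓝 0) ∧
      (∀ n, NY 1 (w n) ≤ C₁ / -b) ∧ ∀ f, Tendsto (fun n => B (w n) f) atTop (𝓝 (B φ f)) := by
  obtain ⟨w, hw, hφw, hw1⟩ := h.splitting.exists_approx_seq_of_isStationary
    (h.dual.isPositive h.duality h.positive) h.b_neg h.C₁_pos.le h.stationary h.nonneg
    h.norm_eq_one
  refine ⟨w, hw, hφw, hw1, fun f => ?_⟩
  simpa using (h.norms.tendsto_pairing_zero hφw f).const_sub (B φ f)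

lemma abs_pairing_le (h : IsHarrisSystem b C₀ C₁ T₀ T₁ η ξ Ξ B S Sd NX NY g ψ φ) (f : X) :
    |B φ f| ≤ C₁ / -b * NX 0 f := by
  obtain ⟨w, -, -, hw1, hlim⟩ := h.exists_approx_seq
  exact le_of_tendsto' (hlim f).abs fun n => (h.norms.pairing_10 _ _).trans
    (mul_le_mul_of_nonneg_right (hw1 n) ((NX 0).nonneg f))

lemma half_le (h : IsHarrisSystem b C₀ C₁ T₀ T₁ η ξ Ξ B S Sd NX NY g ψ φ)
    (hε : IsAdmissible b C₁ η ξ Ξ ε T) : 1 / 2 ≤ Ξ ε * B φ (g ε) := by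
  obtain ⟨w, hw, hφw, hw1, hlim⟩ := h.exists_approx_seq
  exact half_le_of_tendsto_pairing (fun _ => h.norm_eq_one) hw hφw hw1 hε.ξ_nonneg
    hε.mul_le_half (h.interpolation.dual ε hε.mem) (hlim _)

lemma pairing_ψ_le (h : IsHarrisSystem b C₀ C₁ T₀ T₁ η ξ Ξ B S Sd NX NY g ψ φ)
    (hε : IsAdmissible b C₁ η ξ Ξ ε T₁) (hf : 0 ≤ f) :
    B (ψ ε) f ≤ 2 * Ξ ε / η ε T₁ * B φ f := by
  have hψf := h.duality.pairing_nonneg (h.ψ_nonneg ε hε.mem.1) hf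
  have hdual := h.duality.pairing_mono_left
    (h.doblinHarris.dual ε T₁ hε.mem.1 le_rfl φ h.nonneg) hf
  rw [h.stationary T₀ h.T₀_nonneg, h.stationary T₁ (h.T₀_nonneg.trans h.T₀_le), bracketY,
    abs_of_nonneg h.nonneg, map_smul, _root_.smul_apply, smul_eq_mul] at hdual
  have hhalf := h.half_le hε
  have hη := hε.η_pos
  have hΞ := hε.Ξ_pos
  rw [div_mul_eq_mul_div, le_div_iff₀ hη]
  calc B (ψ ε) f * η ε T₁ = 2 * (1 / 2) * (η ε T₁ * B (ψ ε) f) := by ring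
    _ ≤ 2 * (Ξ ε * B φ (g ε)) * (η ε T₁ * B (ψ ε) f) := by gcongr
    _ = 2 * Ξ ε * (η ε T₁ * B φ (g ε) * B (ψ ε) f) := by ring
    _ ≤ 2 * Ξ ε * B φ f := by gcongr

variable [IsOrderedAddMonoid X]

lemma interpolation_invariant (h : IsHarrisSystem b C₀ C₁ T₀ T₁ η ξ Ξ B S Sd NX NY g ψ φ)
    (hε : IsAdmissible b C₁ η ξ Ξ ε T₁) (f : X) :
    NX 0 f ≤ ξ ε * NX 1 f + Ξ ε * (2 * Ξ ε / η ε T₁) * B φ |f| := by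
  refine (h.interpolation.primal ε hε.mem f).trans ?_
  rw [mul_assoc, bracketX]
  have := h.pairing_ψ_le hε (abs_nonneg f)
  have := hε.Ξ_pos
  gcongr

lemma eq_zero_of_pairing_eq_zero (h : IsHarrisSystem b C₀ C₁ T₀ T₁ η ξ Ξ B S Sd NX NY g ψ φ)
    (hadm : ∀ᶠ ε in 𝓝[>] 0, IsAdmissible b C₁ η ξ Ξ ε T₁) (hξ : Tendsto ξ (𝓝[>] 0) (𝓝 0))
    (hf : 0 ≤ f) (hφf : B φ f = 0) : f = 0 := by
  have hle : ∀ᶠ ε in 𝓝[>] 0, NX 0 f ≤ ξ ε * NX 1 f := hadm.mono fun ε hε => by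
    simpa only [abs_of_nonneg hf, hφf, mul_zero, add_zero] using h.interpolation_invariant hε f
  refine (NX 0).eq_zero_of f (le_antisymm (ge_of_tendsto ?_ hle) ((NX 0).nonneg f))
  simpa only [zero_mul] using hξ.mul_const (NX 1 f)

variable [IsOrderedModule ℝ X]

lemma minorization (h : IsHarrisSystem b C₀ C₁ T₀ T₁ η ξ Ξ B S Sd NX NY g ψ φ)
    (hε : IsAdmissible b C₁ η ξ Ξ ε T) (hT : T₁ ≤ T) {D : ℝ}
    (hξD : C₁ / -b * (ξ ε * D) ≤ 1 / 2) (hf : 0 ≤ f) (hD : NX 1 (S.op T₀ f) ≤ D * B φ f) :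
    (η ε T / (2 * (C₁ / -b) * Ξ ε) * B φ f) • g ε ≤ S.op T f := by
  have hη := hε.η_pos
  have hΞ := hε.Ξ_pos
  have hK : 0 < C₁ / -b := div_pos h.C₁_pos (neg_pos.2 h.b_neg)
  have hmass : B φ f ≤ 2 * (C₁ / -b * (Ξ ε * bracketX B (ψ ε) (S.op T₀ f))) :=
    h.isInvariantFunctional.apply_le_of_interpolation h.T₀_nonneg hf hK.le hε.ξ_nonneg
      (fun f => (le_abs_self _).trans (h.abs_pairing_le f)) (h.interpolation.primal ε hε.mem _)
      hD hξD
  refine le_trans (smul_le_smul_of_nonneg_right ?_ (h.g_nonneg ε hε.mem.1))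
    (h.doblinHarris.primal ε T hε.mem.1 hT f hf)
  rw [div_mul_eq_mul_div, div_le_iff₀ (by positivity)]
  calc η ε T * B φ f ≤ η ε T * (2 * (C₁ / -b * (Ξ ε * bracketX B (ψ ε) (S.op T₀ f)))) := by
        gcongr
    _ = _ := by ring

lemma doblin (h : IsHarrisSystem b C₀ C₁ T₀ T₁ η ξ Ξ B S Sd NX NY g ψ φ)
    (hε : IsAdmissible b C₁ η ξ Ξ ε T) (hT : T₁ ≤ T) {P Q A : ℝ} (hP : 0 ≤ P)
    (hlyap : ∀ f, NX 1 (S.op T₀ f) ≤ P * NX 1 f + Q * B φ |f|)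
    (hξD : C₁ / -b * (ξ ε * (P * (2 * A) + Q)) ≤ 1 / 2) (hf : B φ f = 0)
    (hA : NX 1 f ≤ A * B φ |f|) :
    B φ |S.op T f| ≤ (1 - η ε T / (2 * (C₁ / -b) * Ξ ε) * (1 / (2 * Ξ ε))) * B φ |f| := by
  have hη := hε.η_pos
  have hΞ := hε.Ξ_pos
  have hK : 0 < C₁ / -b := div_pos h.C₁_pos (neg_pos.2 h.b_neg)
  have hsub : B φ f⁺ - B φ f⁻ = 0 := by rw [← map_sub, posPart_sub_negPart, hf]
  have hadd : B φ f⁺ + B φ f⁻ = B φ |f| := by rw [← map_add, posPart_add_negPart]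
  have hhalf : ∀ k, 0 ≤ k → k ≤ |f| → B φ |f| = 2 * B φ k →
      (η ε T / (2 * (C₁ / -b) * Ξ ε) * B φ k) • g ε ≤ S.op T k := fun k hk hkf hBk => by
    refine h.minorization hε hT hξD hk ((hlyap k).trans ?_)
    have hNk : NX 1 k ≤ NX 1 f := (NX 1).solid _ _ (by rwa [abs_of_nonneg hk])
    rw [abs_of_nonneg hk, add_mul, mul_assoc P, mul_assoc 2, mul_left_comm 2, ← hBk]
    gcongr
    exact hNk.trans hA
  refine h.isInvariantFunctional.apply_abs_op_le_of_minorization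
    (h.T₀_nonneg.trans (h.T₀_le.trans hT)) (by positivity) hf
    (hhalf _ (posPart_nonneg f)
      (posPart_add_negPart f ▸ le_add_of_nonneg_right (negPart_nonneg f)) (by linarith))
    (hhalf _ (negPart_nonneg f)
      (posPart_add_negPart f ▸ le_add_of_nonneg_left (posPart_nonneg f)) (by linarith)) ?_
  rw [div_le_iff₀ (by positivity)]
  linarith [h.half_le hε]

variable [HasSolidNorm X] [CompleteSpace X]

lemma lyapunov (h : IsHarrisSystem b C₀ C₁ T₀ T₁ η ξ Ξ B S Sd NX NY g ψ φ)
    (hε : IsAdmissible b C₁ η ξ Ξ ε T₁) (ht : 0 ≤ t) (f : X) :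
    NX 1 (S.op t f) ≤ (C₀ + 1) * Real.exp (-(-b / 2 * t)) * NX 1 f
      + lyapunovConst b C₁ T₁ η Ξ ε * B φ |f| := by
  have hb := neg_pos.2 h.b_neg
  have hη := hε.η_pos
  have hΞ := hε.Ξ_pos
  refine h.dissipative.lyapunov h.isInvariantFunctional h.positive h.C₀_nonneg h.C₁_pos.le
    hε.ξ_nonneg (by positivity) (h.interpolation_invariant hε) (by linarith) ?_ ht f
  have hsmall := hε.mul_le_half
  rw [← mul_div_assoc, div_le_iff₀ hb] at hsmall
  linarith

lemma norm_op_le (h : IsHarrisSystem b C₀ C₁ T₀ T₁ η ξ Ξ B S Sd NX NY g ψ φ)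
    (hε : IsAdmissible b C₁ η ξ Ξ ε T₁) (ht : 0 ≤ t) (f : X) :
    NX 1 (S.op t f) ≤ (C₀ + 1) * NX 1 f + lyapunovConst b C₁ T₁ η Ξ ε * B φ |f| := by
  refine (h.lyapunov hε ht f).trans ?_
  have := (NX 1).nonneg f
  have := h.C₀_nonneg
  have := h.b_neg
  gcongr
  exact mul_le_of_le_one_right (by positivity) (Real.exp_le_one_iff.2 (by nlinarith))

lemma isHarrisPair (h : IsHarrisSystem b C₀ C₁ T₀ T₁ η ξ Ξ B S Sd NX NY g ψ φ)
    (hε : IsAdmissible b C₁ η ξ Ξ ε T₁) (hε' : IsAdmissible b C₁ η ξ Ξ ε' T) (hT : T₁ ≤ T)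
    (hexp : (C₀ + 1) * Real.exp (-(-b / 2 * T)) ≤ 1 / 4)
    (hξD : C₁ / -b * (ξ ε' * ((C₀ + 1) * (2 * (4 * lyapunovConst b C₁ T₁ η Ξ ε + 1))
      + lyapunovConst b C₁ T₁ η Ξ ε)) ≤ 1 / 2) (hf : B φ f = 0) :
    IsHarrisPair (C₀ + 1) (lyapunovConst b C₁ T₁ η Ξ ε) T
      (η ε' T / (2 * (C₁ / -b) * Ξ ε') * (1 / (2 * Ξ ε')) / 2)
      (fun t => B φ |S.op t f|) (fun t => NX 1 (S.op t f)) where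
  nonneg_left _ _ := h.duality.pairing_nonneg h.nonneg (abs_nonneg _)
  nonneg_right _ _ := (NX 1).nonneg _
  le_zero := by
    simpa only [h.norm_eq_one, one_mul, LatticeNorm.map_abs] using
      (le_abs_self _).trans (h.norms.pairing_01 φ |S.op 0 f|)
  antitone := h.isInvariantFunctional.antitoneOn_abs_orbit h.positive f
  bounded t ht := by simpa only [S.op_zero_apply] using h.norm_op_le hε ht f
  lyapunov t ht := by
    have hT0 := h.T₀_nonneg.trans (h.T₀_le.trans hT)
    rw [add_comm t, S.op_add_apply hT0 ht]
    refine (h.lyapunov hε hT0 _).trans (add_le_add_left ?_ _)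
    exact mul_le_mul_of_nonneg_right hexp ((NX 1).nonneg _)
  doblin t ht hA := by
    rw [add_comm t, S.op_add_apply (h.T₀_nonneg.trans (h.T₀_le.trans hT)) ht,
      mul_div_cancel₀ _ two_ne_zero]
    have := h.C₀_nonneg
    exact h.doblin hε' hT (by positivity) (h.norm_op_le hε h.T₀_nonneg) hξD
      ((h.isInvariantFunctional.invariant t ht f).trans hf) hA

lemma exists_isStationary (h : IsHarrisSystem b C₀ C₁ T₀ T₁ η ξ Ξ B S Sd NX NY g ψ φ)
    (hε : IsAdmissible b C₁ η ξ Ξ ε T₁) (hN : (NX 1).IsBanach) {C δ : ℝ} (hC : 0 ≤ C)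
    (hδ : 0 < δ) (hdecay : ∀ f, B φ f = 0 → ∀ t, 0 ≤ t →
      NX 1 (S.op t f) ≤ C * Real.exp (-(δ * t)) * NX 1 f) :
    ∃ f₁, 0 ≤ f₁ ∧ B φ f₁ = 1 ∧ S.IsStationary f₁ := by
  have hle : ∀ f, |B φ f| ≤ NX 1 f := fun f => by
    simpa only [h.norm_eq_one, one_mul] using h.norms.pairing_01 φ f
  have hQ := hε.lyapunovConst_nonneg h.b_neg h.C₁_pos.le
  have hpos : 0 < B φ (g ε) :=
    pos_of_mul_pos_right (one_half_pos.trans_le (h.half_le hε)) hε.Ξ_pos.le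
  refine h.isInvariantFunctional.exists_isStationary h.positive hN hle
    (M := C₀ + 1 + lyapunovConst b C₁ T₁ η Ξ ε) (fun t ht f => ?_) hC hδ hdecay
    (smul_nonneg (inv_nonneg.2 hpos.le) (h.g_nonneg ε hε.mem.1))
    (by rw [map_smul, smul_eq_mul, inv_mul_cancel₀ hpos.ne'])
  refine (h.norm_op_le hε ht f).trans ?_
  rw [add_mul (C₀ + 1)]
  gcongr
  simpa only [LatticeNorm.map_abs] using (le_abs_self _).trans (hle |f|)

end IsHarrisSystem

end HarrisSystem

section SpectralGap

lemma eventually_mul_le_of_tendsto_zero {ξ : ℝ → ℝ} (hξ : Tendsto ξ (𝓝[>] 0) (𝓝 0)) (c : ℝ)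
    {e : ℝ} (he : 0 < e) : ∀ᶠ ε in 𝓝[>] 0, ξ ε * c ≤ e := by
  have hlim : Tendsto (fun ε => ξ ε * c) (𝓝[>] 0) (𝓝 0) := by
    simpa only [zero_mul] using hξ.mul_const c
  exact hlim.eventually_le_const he

lemma eventually_isAdmissible {b C₁ T : ℝ} {η : ℝ → ℝ → ℝ} {ξ Ξ : ℝ → ℝ}
    (hη : ∀ ε, 0 < ε → 0 < η ε T) (hξ : ∀ ε ∈ Ioc (0 : ℝ) 1, 0 ≤ ξ ε)
    (hξ_lim : Tendsto ξ (𝓝[>] 0) (𝓝 0)) (hΞ : ∀ ε ∈ Ioc (0 : ℝ) 1, 0 < Ξ ε) :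
    ∀ᶠ ε in 𝓝[>] 0, IsAdmissible b C₁ η ξ Ξ ε T := by
  filter_upwards [Ioc_mem_nhdsGT one_pos, eventually_mul_le_of_tendsto_zero hξ_lim (C₁ / -b)
    one_half_pos] with ε hε hle
  exact ⟨hε, hη ε hε.1, hξ ε hε, hΞ ε hε, hle⟩

lemma exists_time_mul_exp_le {a e : ℝ} (ha : 0 < a) (he : 0 < e) (P T₁ : ℝ) :
    ∃ T, T₁ ≤ T ∧ 0 < T ∧ P * Real.exp (-(a * T)) ≤ e := by
  have hlim := (tendsto_exp_mul_zero (neg_lt_zero.2 ha)).const_mul P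
  simp only [mul_zero, neg_mul] at hlim
  obtain ⟨T, hle, hT₁, hT⟩ := ((hlim.eventually_le_const he).and
    ((eventually_ge_atTop T₁).and (eventually_gt_atTop 0))).exists
  exact ⟨T, hT₁, hT, hle⟩

theorem exists_decay_rate {b C₀ C₁ T₀ T₁ : ℝ} {η : ℝ → ℝ → ℝ} {ξ Ξ : ℝ → ℝ} (hb : b < 0)
    (hC₀ : 0 ≤ C₀) (hC₁ : 0 < C₁) (hη : ∀ ε T, 0 < ε → T₁ ≤ T → 0 < η ε T)
    (hξ : ∀ ε ∈ Ioc (0 : ℝ) 1, 0 ≤ ξ ε) (hξ_lim : Tendsto ξ (𝓝[>] 0) (𝓝 0))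
    (hΞ : ∀ ε ∈ Ioc (0 : ℝ) 1, 0 < Ξ ε) :
    ∃ C δ : ℝ, 1 ≤ C ∧ 0 < δ ∧
      ∀ (X : Type u) (Y : Type v)
        [NormedAddCommGroup X] [NormedSpace ℝ X] [Lattice X] [IsOrderedAddMonoid X]
        [IsOrderedModule ℝ X] [HasSolidNorm X] [CompleteSpace X]
        [NormedAddCommGroup Y] [NormedSpace ℝ Y] [Lattice Y] [IsOrderedAddMonoid Y]
        [IsOrderedModule ℝ Y] [HasSolidNorm Y] [CompleteSpace Y]
        (B : Y →L[ℝ] X →L[ℝ] ℝ) (S : C0Semigroup X) (Sd : C0Semigroup Y)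
        (NX : Fin 2 → LatticeNorm X) (NY : Fin 2 → LatticeNorm Y)
        (g : ℝ → X) (ψ : ℝ → Y) (φ : Y),
        IsHarrisSystem b C₀ C₁ T₀ T₁ η ξ Ξ B S Sd NX NY g ψ φ →
        ∀ f, B φ f = 0 → ∀ t, 0 ≤ t → NX 1 (S.op t f) ≤ C * Real.exp (-(δ * t)) * NX 1 f := by
  have hK : 0 < C₁ / -b := div_pos hC₁ (neg_pos.2 hb)
  obtain ⟨ε, hε⟩ := (eventually_isAdmissible (b := b) (C₁ := C₁)
    (fun ε hε => hη ε T₁ hε le_rfl) hξ hξ_lim hΞ).exists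
  set Q := lyapunovConst b C₁ T₁ η Ξ ε
  have hQ : 0 ≤ Q := hε.lyapunovConst_nonneg hb hC₁.le
  obtain ⟨T, hT, hT_pos, hexp⟩ := exists_time_mul_exp_le (half_pos (neg_pos.2 hb))
    (show (0 : ℝ) < 1 / 4 by norm_num) (C₀ + 1) T₁
  obtain ⟨ε', hε', hξD⟩ := ((eventually_isAdmissible (b := b) (C₁ := C₁)
    (fun ε hε => hη ε T hε hT) hξ hξ_lim hΞ).and (eventually_mul_le_of_tendsto_zero hξ_lim
      (C₁ / -b * ((C₀ + 1) * (2 * (4 * Q + 1)) + Q)) one_half_pos)).exists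
  rw [mul_left_comm] at hξD
  have hηε' := hε'.η_pos
  have hΞε' := hε'.Ξ_pos
  obtain ⟨C, δ, hC, hδ, hrate⟩ := IsHarrisPair.exists_decay_rate (P := C₀ + 1) (by positivity) hQ
    hT_pos (show 0 < η ε' T / (2 * (C₁ / -b) * Ξ ε') * (1 / (2 * Ξ ε')) / 2 by positivity)
  refine ⟨C, δ, hC, hδ, fun X Y _ _ _ _ _ _ _ _ _ _ _ _ _ _ B S Sd NX NY g ψ φ h f hf t ht => ?_⟩
  simpa only [S.op_zero_apply] using hrate _ _ (h.isHarrisPair hε hε' hT hexp hξD hf) t ht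

end SpectralGap

section Conclusion

variable {X Y : Type*}
  [NormedAddCommGroup X] [NormedSpace ℝ X] [Lattice X]
  [NormedAddCommGroup Y] [NormedSpace ℝ Y] [Lattice Y]
  {B : Y →L[ℝ] X →L[ℝ] ℝ} {S : C0Semigroup X} {Sd : C0Semigroup Y}
  {NX : Fin 2 → LatticeNorm X} {NY : Fin 2 → LatticeNorm Y} {g : ℝ → X} {ψ : ℝ → Y} {φ : Y}
  {lam lam₀ lam' b C C₀ C₀' C₁ T₀ T₁ δ ω : ℝ} {η : ℝ → ℝ → ℝ} {ξ Ξ : ℝ → ℝ}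

lemma norm_op_sub_le_of_decay_on_ker {N : LatticeNorm X} {f₁ : X} {ℓ : X →L[ℝ] ℝ}
    (hf₁ : (S.rescale ω).IsStationary f₁) (hℓf₁ : ℓ f₁ = 1)
    (hdecay : ∀ f, ℓ f = 0 → ∀ t, 0 ≤ t →
      N ((S.rescale ω).op t f) ≤ C * Real.exp (-(δ * t)) * N f)
    (f : X) {t : ℝ} (ht : 0 ≤ t) :
    N (S.op t f - (ℓ f * Real.exp (ω * t)) • f₁)
      ≤ C * Real.exp ((ω - δ) * t) * N (f - ℓ f • f₁) := by
  have hop : S.op t f - (ℓ f * Real.exp (ω * t)) • f₁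
      = Real.exp (ω * t) • (S.rescale ω).op t (f - ℓ f • f₁) := by
    rw [(C0Semigroup.op _ t).map_sub, map_smul, hf₁ t ht, C0Semigroup.rescale_op_apply, smul_sub,
      smul_smul, smul_smul, ← Real.exp_add, add_neg_cancel, Real.exp_zero, one_smul, mul_comm]
  have hker : ℓ (f - ℓ f • f₁) = 0 := by simp [hℓf₁]
  rw [hop, N.map_smul_of_nonneg (Real.exp_pos _).le]
  calc Real.exp (ω * t) * N ((S.rescale ω).op t (f - ℓ f • f₁))
      ≤ Real.exp (ω * t) * (C * Real.exp (-(δ * t)) * N (f - ℓ f • f₁)) := by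
        gcongr; exact hdecay _ hker t ht
    _ = C * Real.exp ((ω - δ) * t) * N (f - ℓ f • f₁) := by
        rw [sub_mul, sub_eq_add_neg (ω * t), Real.exp_add]; ring

variable [IsOrderedAddMonoid X] [IsOrderedModule ℝ X] [HasSolidNorm X] [CompleteSpace X]
  [IsOrderedAddMonoid Y] [IsOrderedModule ℝ Y] [HasSolidNorm Y] [CompleteSpace Y]

lemma IsHarrisSystem.exists_unique_isEigentriplet
    (h : IsHarrisSystem b C₀ C₁ T₀ T₁ η ξ Ξ B S Sd NX NY g ψ φ)
    (hadm : ∀ᶠ ε in 𝓝[>] 0, IsAdmissible b C₁ η ξ Ξ ε T₁) (hξ : Tendsto ξ (𝓝[>] 0) (𝓝 0))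
    (hN : (NX 1).IsBanach) (hC : 0 ≤ C) (hδ : 0 < δ)
    (hdecay : ∀ f, B φ f = 0 → ∀ t, 0 ≤ t →
      NX 1 (S.op t f) ≤ C * Real.exp (-(δ * t)) * NX 1 f) :
    ∃ f₁, IsEigentriplet B S Sd (NY 0) 0 f₁ φ ∧
      ∀ μ f φ', IsEigentriplet B S Sd (NY 0) μ f φ' → μ = 0 ∧ f = f₁ ∧ φ' = φ := by
  obtain ⟨ε, hε⟩ := hadm.exists
  obtain ⟨f₁, hf₁, hφf₁, hstat⟩ := h.exists_isStationary hε hN hC hδ hdecay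
  have htrip : IsEigentriplet B S Sd (NY 0) 0 f₁ φ := by
    simpa only [isEigentriplet_iff, C0Semigroup.rescale_zero] using
      ⟨hstat, hf₁, h.stationary, h.nonneg, h.norm_eq_one, hφf₁⟩
  have hlim : ∀ k, B φ k = 0 → Tendsto (fun t => NX 1 (S.op t k)) atTop (𝓝 0) := fun k hk => by
    have hexp := ((tendsto_exp_mul_zero (neg_lt_zero.2 hδ)).const_mul C).mul_const (NX 1 k)
    simp only [mul_zero, zero_mul, neg_mul] at hexp
    exact squeeze_zero' (.of_forall fun t => (NX 1).nonneg _)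
      ((eventually_ge_atTop 0).mono (hdecay k hk)) hexp
  exact ⟨f₁, htrip, fun _ _ _ => IsEigentriplet.unique h.duality h.dual h.norms
    (fun f hf => h.eq_zero_of_pairing_eq_zero hadm hξ hf) hlim htrip⟩

lemma exists_isHarrisSystem_rescale (hB : OrderDuality B) (hS : S.IsPositive)
    (hd : DualSemigroups B S Sd) (hN : CompatibleNorms B NX NY)
    (hdiss : StronglyDissipative lam C₀ C₁ S NX) (hsplit : DualSplitting lam C₀ C₁ Sd NY)
    (hsuper : HasSupereigenvector lam₀ S ∨ HasSupereigenvector lam₀ Sd)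
    (hDH : DoblinHarris T₀ T₁ η B S Sd g ψ) (hint : Interpolation ξ Ξ B NX NY g ψ)
    (hgrowth : GrowthBound lam' C₀' S (NX 1)) (hcompact : WeaklySeqCompactBalls B (NY 1))
    (hlam : lam < lam₀) (hC₀ : 0 ≤ C₀) (hC₁ : 0 < C₁) (hT₀ : 0 ≤ T₀) (hT₁ : T₀ ≤ T₁)
    (hη : ∀ ε T, 0 < ε → T₁ ≤ T → 0 ≤ η ε T) (hξ : ∀ ε ∈ Ioc (0 : ℝ) 1, 0 ≤ ξ ε)
    (hξ_lim : Tendsto ξ (𝓝[>] 0) (𝓝 0)) (hΞ : ∀ ε ∈ Ioc (0 : ℝ) 1, 0 ≤ Ξ ε)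
    (hg : ∀ ε, 0 < ε → 0 ≤ g ε) (hψ : ∀ ε, 0 < ε → 0 ≤ ψ ε) :
    ∃ ω φ, IsHarrisSystem (lam - lam₀) C₀ C₁ T₀ T₁
      (fun ε T => η ε T * Real.exp (-(lam' * (T - T₀)))) ξ Ξ B (S.rescale ω) (Sd.rescale ω)
      NX NY g ψ φ := by
  obtain ⟨ε, hle, hε⟩ := ((eventually_mul_le_of_tendsto_zero hξ_lim C₁
    (by linarith : 0 < (lam₀ - lam) / 4)).and (Ioc_mem_nhdsGT one_pos)).exists
  obtain ⟨ω, φ, hω, hφ, hφ1, hstat⟩ := exists_dual_eigenvector hB hS hd hN hdiss hsplit hsuper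
    hgrowth hcompact hlam hC₀ hC₁.le (hg ε hε.1) (hψ ε hε.1) (hξ ε hε) (hΞ ε hε)
    (hint.primal ε hε) (hint.dual ε hε) ((mul_comm _ _).trans_le hle)
  have hφ_ne : φ ≠ 0 := by
    rintro rfl
    simp at hφ1
  have hω' : ω ≤ lam' := sub_nonneg.1 <|
    (hgrowth.rescale ω).nonneg_of_isStationary hB (hd.rescale ω) hN hstat hφ_ne
  exact ⟨ω, φ, {
    b_neg := sub_neg.2 hlam
    C₀_nonneg := hC₀
    C₁_pos := hC₁
    T₀_nonneg := hT₀
    T₀_le := hT₁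
    duality := hB
    positive := hS.rescale ω
    dual := hd.rescale ω
    norms := hN
    dissipative := (hdiss.rescale ω).mono (sub_le_sub_left hω lam) hC₀ hC₁.le
    splitting := (hsplit.rescale ω).mono (sub_le_sub_left hω lam) hC₀ hC₁.le
    doblinHarris := hDH.rescale hB hS (hd.isPositive hB hS) hT₀ hT₁ hη hg hψ hω'
    interpolation := hint
    g_nonneg := hg
    ψ_nonneg := hψ
    stationary := hstat
    nonneg := hφ
    norm_eq_one := hφ1 }⟩

end Conclusion

theorem theorem6p1_general (lam lam₀ lam' C₀ C₁ C₀' T₀ T₁ : ℝ) (η : ℝ → ℝ → ℝ) (ξ Ξ : ℝ → ℝ)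
    (hlam : lam < lam₀) (hC₀ : 0 ≤ C₀) (hC₁ : 0 < C₁) (hT₀ : 0 ≤ T₀) (hT₁ : T₀ ≤ T₁)
    (hη : ∀ ε T, 0 < ε → T₁ ≤ T → 0 < η ε T) (hξ : ∀ ε ∈ Ioc (0 : ℝ) 1, 0 ≤ ξ ε)
    (hξ_lim : Tendsto ξ (𝓝[>] 0) (𝓝 0)) (hΞ : ∀ ε ∈ Ioc (0 : ℝ) 1, 0 < Ξ ε) :
    ∃ C δ : ℝ, 1 ≤ C ∧ 0 < δ ∧
      ∀ (X : Type u) (Y : Type v)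
        [NormedAddCommGroup X] [NormedSpace ℝ X] [Lattice X] [IsOrderedAddMonoid X]
        [IsOrderedModule ℝ X] [HasSolidNorm X] [CompleteSpace X]
        [NormedAddCommGroup Y] [NormedSpace ℝ Y] [Lattice Y] [IsOrderedAddMonoid Y]
        [IsOrderedModule ℝ Y] [HasSolidNorm Y] [CompleteSpace Y]
        (B : Y →L[ℝ] X →L[ℝ] ℝ) (S : C0Semigroup X) (Sd : C0Semigroup Y)
        (NX : Fin 2 → LatticeNorm X) (NY : Fin 2 → LatticeNorm Y)
        (g : ℝ → X) (ψ : ℝ → Y),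
        OrderDuality B → S.IsPositive → DualSemigroups B S Sd →
        CompatibleNorms B NX NY →
        StronglyDissipative lam C₀ C₁ S NX →
        (HasSupereigenvector lam₀ S ∨ HasSupereigenvector lam₀ Sd) →
        (∀ ε, 0 < ε → 0 ≤ g ε) → (∀ ε, 0 < ε → 0 ≤ ψ ε) →
        DoblinHarris T₀ T₁ η B S Sd g ψ →
        Interpolation ξ Ξ B NX NY g ψ →
        (NX 1).IsBanach → GrowthBound lam' C₀' S (NX 1) →
        DualSplitting lam C₀ C₁ Sd NY →
        WeaklySeqCompactBalls B (NY 1) →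
        ∃ (lam₁ : ℝ) (f₁ : X) (φ₁ : Y),
          IsEigentriplet B S Sd (NY 0) lam₁ f₁ φ₁ ∧
          (∀ (μ : ℝ) (f : X) (φ : Y),
            IsEigentriplet B S Sd (NY 0) μ f φ → μ = lam₁ ∧ f = f₁ ∧ φ = φ₁) ∧
          ∃ lam₂ : ℝ, lam₂ = lam₁ - δ ∧ ∀ (f : X) (t : ℝ), 0 ≤ t →
            NX 1 (S.op t f - (B φ₁ f * Real.exp (lam₁ * t)) • f₁)
              ≤ C * Real.exp (lam₂ * t) * NX 1 (f - B φ₁ f • f₁) := by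
  have hη' : ∀ ε T, 0 < ε → T₁ ≤ T → 0 < η ε T * Real.exp (-(lam' * (T - T₀))) :=
    fun ε T hε hT => mul_pos (hη ε T hε hT) (Real.exp_pos _)
  obtain ⟨C, δ, hC, hδ, hrate⟩ :=
    exists_decay_rate.{u, v} (T₀ := T₀) (sub_neg.2 hlam) hC₀ hC₁ hη' hξ hξ_lim hΞ
  refine ⟨C, δ, hC, hδ, fun X Y _ _ _ _ _ _ _ _ _ _ _ _ _ _ B S Sd NX NY g ψ hB hS hd hN hdiss
    hsuper hg hψ hDH hint hBanach hgrowth hsplit hcompact => ?_⟩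
  obtain ⟨ω, φ, h⟩ := exists_isHarrisSystem_rescale hB hS hd hN hdiss hsplit hsuper hDH hint
    hgrowth hcompact hlam hC₀ hC₁ hT₀ hT₁ (fun ε T hε hT => (hη ε T hε hT).le) hξ hξ_lim
    (fun ε hε => (hΞ ε hε).le) hg hψ
  have hdecay := hrate X Y B _ _ NX NY g ψ φ h
  obtain ⟨f₁, htrip, hunique⟩ := h.exists_unique_isEigentriplet
    (eventually_isAdmissible (fun ε hε => hη' ε T₁ hε le_rfl) hξ hξ_lim hΞ) hξ_lim hBanach
    (zero_le_one.trans hC) hδ hdecay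
  have hstat : (S.rescale ω).IsStationary f₁ := by
    simpa only [C0Semigroup.rescale_zero] using (isEigentriplet_iff.1 htrip).1
  refine ⟨ω, f₁, φ, by simpa only [add_zero] using isEigentriplet_rescale_iff.1 htrip,
    fun μ f φ' h' => ?_, ω - δ, rfl, fun f t ht =>
      norm_op_sub_le_of_decay_on_ker hstat htrip.pairing hdecay f ht⟩
  obtain ⟨hμ, hf, hφ⟩ := hunique (μ - ω) f φ' <|
    isEigentriplet_rescale_iff.2 ((add_sub_cancel ω μ).symm ▸ h')
  exact ⟨sub_eq_zero.1 hμ, hf, hφ⟩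

end KreinRutman

open KreinRutman in
/-- The constants `C` and `δ = lam₁ - lam₂` are chosen before the spaces, the norms and the
semigroups: they depend only on the numerical constants of the assumptions. -/
theorem theorem6p1
    (lam lam₀ lam' C₀ C₁ C₀' T₀ T₁ : ℝ) (η : ℝ → ℝ → ℝ) (ξ Ξ : ℝ → ℝ)
    (hlam : lam < lam₀) (hC₀ : 0 < C₀) (hC₁ : 0 < C₁) (hC₀' : 1 ≤ C₀')
    (hT₀ : 0 ≤ T₀) (hT₁ : T₀ < T₁)
    (hη : ∀ ε T : ℝ, 0 < ε → T₁ ≤ T → 0 < η ε T)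
    (hξ_pos : ∀ ε ∈ Set.Ioc (0 : ℝ) 1, 0 < ξ ε)
    (hξ_mono : MonotoneOn ξ (Set.Ioc 0 1))
    (hξ_lim : Filter.Tendsto ξ (nhdsWithin 0 (Set.Ioi 0)) (nhds 0))
    (hΞ_pos : ∀ ε ∈ Set.Ioc (0 : ℝ) 1, 0 < Ξ ε)
    (hΞ_anti : AntitoneOn Ξ (Set.Ioc 0 1))
    (hΞ_lim : Filter.Tendsto Ξ (nhdsWithin 0 (Set.Ioi 0)) Filter.atTop) :
    ∃ C δ : ℝ, 1 ≤ C ∧ 0 < δ ∧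
      ∀ (X : Type u) (Y : Type v)
        [NormedAddCommGroup X] [NormedSpace ℝ X] [Lattice X] [IsOrderedAddMonoid X]
        [IsOrderedModule ℝ X] [HasSolidNorm X] [CompleteSpace X]
        [NormedAddCommGroup Y] [NormedSpace ℝ Y] [Lattice Y] [IsOrderedAddMonoid Y]
        [IsOrderedModule ℝ Y] [HasSolidNorm Y] [CompleteSpace Y]
        (B : Y →L[ℝ] X →L[ℝ] ℝ) (S : C0Semigroup X) (Sd : C0Semigroup Y)
        (NX : Fin 2 → LatticeNorm X) (NY : Fin 2 → LatticeNorm Y)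
        (g : ℝ → X) (ψ : ℝ → Y),
        OrderDuality B → S.IsPositive → DualSemigroups B S Sd →
        CompatibleNorms B NX NY →
        StronglyDissipative lam C₀ C₁ S NX →
        (HasSupereigenvector lam₀ S ∨ HasSupereigenvector lam₀ Sd) →
        BoundedDecreasingFamily g → BoundedDecreasingFamily ψ →
        DoblinHarris T₀ T₁ η B S Sd g ψ →
        Interpolation ξ Ξ B NX NY g ψ →
        (NX 1).IsBanach → GrowthBound lam' C₀' S (NX 1) →
        DualSplitting lam C₀ C₁ Sd NY →
        WeaklySeqCompactBalls B (NY 1) →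
        ∃ (lam₁ : ℝ) (f₁ : X) (φ₁ : Y),
          IsEigentriplet B S Sd (NY 0) lam₁ f₁ φ₁ ∧
          (∀ (μ : ℝ) (f : X) (φ : Y),
            IsEigentriplet B S Sd (NY 0) μ f φ → μ = lam₁ ∧ f = f₁ ∧ φ = φ₁) ∧
          ∃ lam₂ : ℝ, lam₂ = lam₁ - δ ∧ ∀ (f : X) (t : ℝ), 0 ≤ t →
            NX 1 (S.op t f - (B φ₁ f * Real.exp (lam₁ * t)) • f₁)
              ≤ C * Real.exp (lam₂ * t) * NX 1 (f - B φ₁ f • f₁) := by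
  obtain ⟨C, δ, hC, hδ, h⟩ := theorem6p1_general lam lam₀ lam' C₀ C₁ C₀' T₀ T₁ η ξ Ξ hlam hC₀.le
    hC₁ hT₀ hT₁.le hη (fun ε hε => (hξ_pos ε hε).le) hξ_lim hΞ_pos
  refine ⟨C, δ, hC, hδ, ?_⟩
  intro X Y _ _ _ _ _ _ _ _ _ _ _ _ _ _ B S Sd NX NY g ψ hB hS hd hN hdiss hsuper hg hψ
  exact h X Y B S Sd NX NY g ψ hB hS hd hN hdiss hsuper hg.nonneg hψ.nonneg
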